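/- Let $p,q\in(1,\infty)$ and $r\in(\tfrac12,\infty)$ satisfy $\frac1p+\frac1q=\frac1r$. There is a constant $C_{p,q}\in[0,\infty)$, depending only on $p$ and $q$, such that the following holds. Let $\mathcal F=(\mathcal F_n)_{n=0}^\infty$ be a filtration on a probability space, let $T_0\le T_1\le T_2\le\cdots$ be stopping times with respect to $\mathcal F$ with values in $\{0,1,2,\ldots\}$, each $T_k$ being bounded, and let $f=(f_n)_{n=0}^\infty$ and $g=(g_n)_{n=0}^\infty$ be real-valued martingales with respect to $\mathcal F$. For $k\ge1$ and $n\ge0$ put $$f^{(k)}_n := f_{\min\{\max\{n,T_{k-1}\},T_k\}}-f_{T_{k-1}},\qquad g^{(k)}_n := g_{\min\{\max\{n,T_{k-1}\},T_k\}}-g_{T_{k-1}},$$ and for processes $u=(u_n)_{n=0}^\infty$, $v=(v_n)_{n=0}^\infty$ let $\Pi_n(u,v):=\sum_{j=1}^{n}u_{j-1}(v_j-v_{j-1})$ denote their paraproduct (so $\Pi_0(u,v)=0$). Then, for each $k\geq 1$, the sequence $(\Pi_n(f^{(k)},g^{(k)}))_{n=0}^\infty$ is constant from some deterministic index on, so that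 $\Pi_\infty(f^{(k)},g^{(k)}):=\lim_{n\to\infty}\Pi_n(f^{(k)},g^{(k)})$ is well defined, and $$\Big\|\sum_{k=1}^\infty\big|\Pi_\infty(f^{(k)},g^{(k)})\big|\Big\|_{\mathrm L^r}\le C_{p,q}\,\|f\|_{\mathrm L^p}\,\|g\|_{\mathrm L^q}.$$ Here $\|h\|_{\mathrm L^s}:=(\mathbb E|h|^s)^{1/s}$ for a random variable $h$, and $\|f\|_{\mathrm L^p}:=\sup_{n\ge0}\|f_n\|_{\mathrm L^p}$, $\|g\|_{\mathrm L^q}:=\sup_{n\ge0}\|g_n\|_{\mathrm L^q}$ for the martingales; these quantities take values in $[0,\infty]$, with $0\cdot\infty=0$. -/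

import Mathlib

open MeasureTheory Filter
open scoped ENNReal NNReal

noncomputable section

/-- The `L^p` norm of a process: the supremum over `n` of the `L^p` norms of `f n`. -/
def processLpNorm {Ω : Type*} [MeasurableSpace Ω] (f : ℕ → Ω → ℝ) (p : ℝ≥0∞) (μ : Measure Ω) :
    ℝ≥0∞ :=
  ⨆ n, eLpNorm (f n) p μ

/-- The paraproduct `Π_n(f,g) = ∑_{j=1}^n f_{j-1} (g_j - g_{j-1})`; the summation index below
is `j - 1`. -/
def paraproduct {Ω : Type*} (f g : ℕ → Ω → ℝ) (n : ℕ) (ω : Ω) : ℝ :=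
  ∑ j ∈ Finset.range n, f j ω * (g (j + 1) ω - g j ω)

/-- The terminal value `Π_∞(f,g) = lim_{n → ∞} Π_n(f,g)`, taken pointwise. -/
def paraproductInfty {Ω : Type*} (f g : ℕ → Ω → ℝ) (ω : Ω) : ℝ :=
  limUnder atTop (fun n => paraproduct f g n ω)

/-- The piece of the process `f` between the random times `S ≤ T`:
at time `n` it equals `f_{(n ∨ S) ∧ T} - f_S`. -/
def localizedPiece {Ω : Type*} (f : ℕ → Ω → ℝ) (S T : Ω → ℕ) (n : ℕ) (ω : Ω) : ℝ :=
  f (min (max n (S ω)) (T ω)) ω - f (S ω) ω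

end

/-! The absolute values are removed pathwise, so that only scalar martingale transforms remain. A
pathwise Davis inequality (`abs_paraproduct_le`) bounds each |Π(f⁽ᵏ⁾, g⁽ᵏ⁾)| by the maximum of
|f⁽ᵏ⁾| times the square function of g⁽ᵏ⁾, plus a signed transform of g⁽ᵏ⁾. Cauchy–Schwarz in k
separates the first product. The squared square functions of the g⁽ᵏ⁾ sum to at most that of g. The
squared maxima of the f⁽ᵏ⁾ are bounded by squared square functions plus a signed transform of f⁽ᵏ⁾
(`runMax_sq_le`). Since the intervals [T_k, T_{k+1}) are disjoint, signed transforms of the pieces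
add up to one transform of g, or of f, with adapted coefficients of size at most a constant times
the running maximum of f (`sum_abs_paraproduct_le`). No vector-valued estimate is needed.

What remains is the scalar bound `transformBound`: if |a_n| ≤ A_n with A adapted and increasing, the
maximal function of Π(a, g) has L^r norm at most C ‖A_n‖_p ‖max |g|‖_q, for every q > 1, including r
< 1. Taking a = g at exponents (q, q, q/2) also gives the square function estimate.

For q > 2 the scalar bound starts at r = 2, where it follows from zero-mean transforms and Doob. The
expansion of Π(a, g)² into (A g)² and further transforms of the same g passes from r/2 to r
(`TransformBound.double`); splitting off a power of A and summing by parts passes from r = 2 down to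
smaller r (`TransformBound.of_lt`).

For 1 < q ≤ 2 a nonnegative g is written as u², where u = √g is a supermartingale in L^{2q} with 2q
> 2. In its Doob decomposition u = M - B the increasing part B is controlled by max u
(`lpn_compensator_le`), and the transform of u² reduces to transforms of M. A general g is split
through the conditional expectations of the positive and negative parts of g_n. -/

noncomputable section

/-! ### `L^p` seminorms with real exponents -/

section LpAPI

variable {Ω : Type*} {m : MeasurableSpace Ω} {μ : Measure Ω}

/-- The `L^p` seminorm of a real random variable, for a real exponent. -/
abbrev lpn (μ : Measure Ω) (p : ℝ) (X : Ω → ℝ) : ℝ≥0∞ := eLpNorm X (ENNReal.ofReal p) μ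

/-- Membership in `L^p` for a real exponent. -/
abbrev InLp (μ : Measure Ω) (p : ℝ) (X : Ω → ℝ) : Prop := MemLp X (ENNReal.ofReal p) μ

lemma holderTriple_ofReal {p q r : ℝ} (h : p.HolderTriple q r) :
    ENNReal.HolderTriple (ENNReal.ofReal p) (ENNReal.ofReal q) (ENNReal.ofReal r) where
  inv_add_inv_eq_inv := by
    have hp := h.pos
    have hq := h.symm.pos
    have hr := h.pos'
    rw [← ENNReal.ofReal_inv_of_pos hp, ← ENNReal.ofReal_inv_of_pos hq,
      ← ENNReal.ofReal_inv_of_pos hr, ← ENNReal.ofReal_add (by positivity) (by positivity),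
      h.inv_add_inv_eq_inv]

lemma lpn_mul_le {p q r : ℝ} (h : p.HolderTriple q r) {X Y : Ω → ℝ}
    (hX : AEStronglyMeasurable X μ) (hY : AEStronglyMeasurable Y μ) :
    lpn μ r (fun ω => X ω * Y ω) ≤ lpn μ p X * lpn μ q Y := by
  have := holderTriple_ofReal h
  have h' := eLpNorm_smul_le_mul_eLpNorm (p := ENNReal.ofReal p) (q := ENNReal.ofReal q)
    (r := ENNReal.ofReal r) hY hX
  rw [smul_eq_mul] at h'
  exact h'

lemma InLp.mul {p q r : ℝ} (h : p.HolderTriple q r) {X Y : Ω → ℝ}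
    (hX : InLp μ p X) (hY : InLp μ q Y) : InLp μ r (fun ω => X ω * Y ω) := by
  have := holderTriple_ofReal h
  exact MemLp.mul' (p := ENNReal.ofReal p) (q := ENNReal.ofReal q) hY hX

lemma lpn_rpow {p s : ℝ} (hs : 0 < s) {X : Ω → ℝ} (hX : ∀ ω, 0 ≤ X ω) :
    lpn μ (p / s) (fun ω => X ω ^ s) = lpn μ p X ^ s := by
  have h := eLpNorm_norm_rpow (p := ENNReal.ofReal (p / s)) (μ := μ) X hs
  rw [← ENNReal.ofReal_mul' hs.le, div_mul_cancel₀ _ hs.ne'] at h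
  rw [← h]
  congr 1
  ext ω
  rw [Real.norm_of_nonneg (hX ω)]

lemma InLp.rpow {p s : ℝ} (hs : 0 < s) {X : Ω → ℝ} (hX : ∀ ω, 0 ≤ X ω) (h : InLp μ p X) :
    InLp μ (p / s) (fun ω => X ω ^ s) := by
  refine ⟨((h.1.aemeasurable).pow_const s).aestronglyMeasurable, ?_⟩
  have := lpn_rpow (μ := μ) (p := p) hs hX
  rw [lpn] at this
  rw [this]
  exact ENNReal.rpow_lt_top_of_nonneg hs.le h.2.ne

lemma lpn_abs (p : ℝ) (X : Ω → ℝ) : lpn μ p (fun ω => |X ω|) = lpn μ p X :=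
  eLpNorm_norm X

lemma lpn_sq {r : ℝ} (X : Ω → ℝ) : lpn μ (r / 2) (fun ω => X ω ^ 2) = lpn μ r X ^ 2 := by
  have h := lpn_rpow (μ := μ) (p := r) (s := 2) two_pos (X := fun ω => |X ω|)
    (fun ω => abs_nonneg _)
  rw [lpn_abs] at h
  simpa using h

lemma InLp.sq {r : ℝ} {X : Ω → ℝ} (h : InLp μ r X) : InLp μ (r / 2) (fun ω => X ω ^ 2) := by
  refine ⟨h.1.pow 2, ?_⟩
  have := lpn_sq (μ := μ) (r := r) X
  rw [lpn] at this
  rw [this]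
  exact ENNReal.pow_lt_top h.2

lemma lpn_mono {p : ℝ} {X Y : Ω → ℝ} (h : ∀ᵐ ω ∂μ, |X ω| ≤ Y ω) : lpn μ p X ≤ lpn μ p Y :=
  eLpNorm_mono_ae_real h

lemma InLp.mono {p : ℝ} {X Y : Ω → ℝ} (hY : InLp μ p Y) (hX : AEStronglyMeasurable X μ)
    (h : ∀ᵐ ω ∂μ, |X ω| ≤ Y ω) : InLp μ p X :=
  ⟨hX, (lpn_mono h).trans_lt hY.2⟩

lemma lpn_const_mul {p : ℝ} (c : ℝ≥0) (X : Ω → ℝ) :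
    lpn μ p (fun ω => (c : ℝ) * X ω) = c * lpn μ p X := by
  have := eLpNorm_const_smul (p := ENNReal.ofReal p) (μ := μ) (c : ℝ) X
  simpa [Pi.smul_def, Real.enorm_eq_ofReal] using this

/-- The quasi-triangle constant. -/
def addConst (p : ℝ) : ℝ≥0 := (ENNReal.LpAddConst (ENNReal.ofReal p)).toNNReal

lemma lpn_add_le (p : ℝ) {X Y : Ω → ℝ}
    (hX : AEStronglyMeasurable X μ) (hY : AEStronglyMeasurable Y μ) :
    lpn μ p (fun ω => X ω + Y ω) ≤ addConst p * (lpn μ p X + lpn μ p Y) := by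
  have := eLpNorm_add_le' hX hY (ENNReal.ofReal p)
  rwa [← ENNReal.coe_toNNReal (ENNReal.LpAddConst_lt_top (ENNReal.ofReal p)).ne] at this

lemma lpn_one_eq {X : Ω → ℝ} (hX : ∀ ω, 0 ≤ X ω) (hi : Integrable X μ) :
    lpn μ 1 X = ENNReal.ofReal (∫ ω, X ω ∂μ) := by
  rw [lpn, ENNReal.ofReal_one, eLpNorm_one_eq_lintegral_enorm,
    ofReal_integral_eq_lintegral_ofReal hi (ae_of_all _ hX)]
  exact lintegral_congr fun ω => Real.enorm_eq_ofReal (hX ω)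

/-- The self-improving step behind Doob's inequality. -/
lemma lpn_le_of_integral_rpow_le {p c : ℝ} (hp : 1 < p) (hc : 0 ≤ c) {X Y : Ω → ℝ}
    (hX0 : ∀ ω, 0 ≤ X ω) (hY0 : ∀ ω, 0 ≤ Y ω) (hX : InLp μ p X) (hY : InLp μ p Y)
    (h : ∫ ω, X ω ^ p ∂μ ≤ c * ∫ ω, X ω ^ (p - 1) * Y ω ∂μ) :
    lpn μ p X ≤ ENNReal.ofReal c * lpn μ p Y := by
  have hp0 : 0 < p := by linarith
  have hp1 : 0 < p - 1 := by linarith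
  have hT : (p / (p - 1)).HolderTriple p 1 :=
    ⟨by rw [inv_div]; field_simp; ring, by positivity, hp0⟩
  have hi1 : Integrable (fun ω => X ω ^ p) μ := by
    have := InLp.rpow hp0 hX0 hX
    rw [div_self hp0.ne', InLp, ENNReal.ofReal_one] at this
    exact memLp_one_iff_integrable.1 this
  have hi2 : Integrable (fun ω => X ω ^ (p - 1) * Y ω) μ := by
    have := InLp.mul hT (InLp.rpow hp1 hX0 hX) hY
    rw [InLp, ENNReal.ofReal_one] at this
    exact memLp_one_iff_integrable.1 this
  have e1 : lpn μ p X ^ p = ENNReal.ofReal (∫ ω, X ω ^ p ∂μ) := by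
    rw [← lpn_rpow hp0 hX0, div_self hp0.ne']
    exact lpn_one_eq (fun ω => Real.rpow_nonneg (hX0 ω) _) hi1
  have e2 : ENNReal.ofReal (∫ ω, X ω ^ (p - 1) * Y ω ∂μ) ≤ lpn μ p X ^ (p - 1) * lpn μ p Y := by
    rw [← lpn_one_eq (fun ω => mul_nonneg (Real.rpow_nonneg (hX0 ω) _) (hY0 ω)) hi2,
      ← lpn_rpow hp1 hX0]
    exact lpn_mul_le hT (InLp.rpow hp1 hX0 hX).1 hY.1
  have key : lpn μ p X ^ p ≤ ENNReal.ofReal c * (lpn μ p X ^ (p - 1) * lpn μ p Y) := by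
    rw [e1]
    refine (ENNReal.ofReal_le_ofReal h).trans ?_
    rw [ENNReal.ofReal_mul hc]
    gcongr
  -- The estimate is about to be divided by ‖X‖^(p-1), which must be nonzero and finite.
  by_cases h0 : lpn μ p X = 0
  · simp [h0]
  have e3 : lpn μ p X ^ p = lpn μ p X ^ (p - 1) * lpn μ p X := by
    conv_rhs => rw [← ENNReal.rpow_one (lpn μ p X), ← ENNReal.rpow_mul, one_mul]
    rw [← ENNReal.rpow_add _ _ h0 hX.2.ne]
    congr 1; ring
  rw [e3, mul_left_comm] at key
  refine (ENNReal.mul_le_mul_iff_right ?_ ?_).1 key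
  · exact (ENNReal.rpow_pos (pos_iff_ne_zero.2 h0) hX.2.ne).ne'
  · exact ENNReal.rpow_ne_top_of_nonneg hp1.le hX.2.ne

end LpAPI

/-! ### Running maxima and martingale transforms -/

section Transforms

variable {Ω : Type*} {m : MeasurableSpace Ω} {μ : Measure Ω}

/-- The running maximum `max_{i ≤ n} |X_i|`. -/
def runMax (X : ℕ → Ω → ℝ) : ℕ → Ω → ℝ
  | 0, ω => |X 0 ω|
  | n + 1, ω => max (runMax X n ω) |X (n + 1) ω|

lemma runMax_mono (X : ℕ → Ω → ℝ) (ω : Ω) : Monotone fun n => runMax X n ω :=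
  monotone_nat_of_le_succ fun _ => le_max_left _ _

lemma abs_le_runMax_self (X : ℕ → Ω → ℝ) (n : ℕ) (ω : Ω) : |X n ω| ≤ runMax X n ω := by
  cases n
  · exact le_rfl
  · exact le_max_right _ _

lemma abs_le_runMax (X : ℕ → Ω → ℝ) {i n : ℕ} (h : i ≤ n) (ω : Ω) : |X i ω| ≤ runMax X n ω :=
  (abs_le_runMax_self X i ω).trans (runMax_mono X ω h)

lemma runMax_nonneg (X : ℕ → Ω → ℝ) (n : ℕ) (ω : Ω) : 0 ≤ runMax X n ω :=
  (abs_nonneg _).trans (abs_le_runMax_self X n ω)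

lemma runMax_le {X : ℕ → Ω → ℝ} {n : ℕ} {ω : Ω} {c : ℝ} (h : ∀ i ≤ n, |X i ω| ≤ c) :
    runMax X n ω ≤ c := by
  induction n with
  | zero => exact h 0 le_rfl
  | succ n ih => exact max_le (ih fun i hi => h i (by omega)) (h _ le_rfl)

lemma abs_runMax (X : ℕ → Ω → ℝ) (n : ℕ) (ω : Ω) : |runMax X n ω| = runMax X n ω :=
  abs_of_nonneg (runMax_nonneg X n ω)

lemma runMax_stronglyAdapted {ℱ : Filtration ℕ m} {X : ℕ → Ω → ℝ} (hX : StronglyAdapted ℱ X) :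
    StronglyAdapted ℱ (runMax X) := by
  intro n
  induction n with
  | zero => exact (hX 0).norm
  | succ n ih =>
    exact @StronglyMeasurable.sup Ω ℝ _ _ (ℱ (n + 1)) _ _ _ (ih.mono (ℱ.mono n.le_succ))
      (hX (n + 1)).norm

lemma InLp.runMax {p : ℝ} {X : ℕ → Ω → ℝ} (hX : ∀ n, InLp μ p (X n)) (n : ℕ) :
    InLp μ p (runMax X n) := by
  induction n with
  | zero => exact (hX 0).norm
  | succ n ih => exact ih.sup (hX (n + 1)).norm

lemma StronglyAdapted.aesm {ℱ : Filtration ℕ m} {X : ℕ → Ω → ℝ} (hX : StronglyAdapted ℱ X)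
    (n : ℕ) : AEStronglyMeasurable (X n) μ :=
  ((hX n).mono (ℱ.le n)).aestronglyMeasurable

@[simp] lemma paraproduct_zero (a g : ℕ → Ω → ℝ) (ω : Ω) : paraproduct a g 0 ω = 0 := by
  simp [paraproduct]

lemma paraproduct_succ (a g : ℕ → Ω → ℝ) (n : ℕ) (ω : Ω) :
    paraproduct a g (n + 1) ω = paraproduct a g n ω + a n ω * (g (n + 1) ω - g n ω) := by
  simp [paraproduct, Finset.sum_range_succ]

lemma paraproduct_stronglyAdapted {ℱ : Filtration ℕ m} {a g : ℕ → Ω → ℝ}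
    (ha : StronglyAdapted ℱ a) (hg : StronglyAdapted ℱ g) :
    StronglyAdapted ℱ (paraproduct a g) := by
  intro n
  induction n with
  | zero =>
    have : paraproduct a g 0 = fun _ => 0 := by ext; simp
    rw [this]; exact stronglyMeasurable_const
  | succ n ih =>
    have : paraproduct a g (n + 1) = paraproduct a g n + a n * (g (n + 1) - g n) := by
      ext ω; exact paraproduct_succ a g n ω
    rw [this]
    have hn := ℱ.mono n.le_succ
    exact (ih.mono hn).add (((ha n).mono hn).mul ((hg (n + 1)).sub ((hg n).mono hn)))

lemma InLp.paraproduct {p q r : ℝ} (h : p.HolderTriple q r) {a g : ℕ → Ω → ℝ}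
    (ha : ∀ n, InLp μ p (a n)) (hg : ∀ n, InLp μ q (g n)) (n : ℕ) :
    InLp μ r (paraproduct a g n) := by
  have : _root_.paraproduct a g n =
      fun ω => ∑ j ∈ Finset.range n, a j ω * (g (j + 1) ω - g j ω) := rfl
  rw [this]
  exact memLp_finsetSum _ fun j _ => InLp.mul h (ha j) ((hg (j + 1)).sub (hg j))

/-- The factor known at time j comes out of the conditional expectation, and the increment after
time j has conditional mean zero. Only integrability of the product is asked for, since the
coefficients used later are unbounded. -/
lemma integral_mul_martingale_sub {ℱ : Filtration ℕ m} [IsFiniteMeasure μ] {g : ℕ → Ω → ℝ}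
    (hg : Martingale g ℱ μ) {X : Ω → ℝ} {j : ℕ} (hX : StronglyMeasurable[ℱ j] X)
    (hi : Integrable (fun ω => X ω * (g (j + 1) ω - g j ω)) μ) :
    ∫ ω, X ω * (g (j + 1) ω - g j ω) ∂μ = 0 := by
  have hd : Integrable (g (j + 1) - g j) μ := (hg.integrable _).sub (hg.integrable _)
  have h1 := condExp_mul_of_stronglyMeasurable_left (μ := μ) hX (g := g (j + 1) - g j) hi hd
  have h2 : μ[g (j + 1) - g j | ℱ j] =ᵐ[μ] 0 := by
    filter_upwards [condExp_sub (hg.integrable (j + 1)) (hg.integrable j) (ℱ j),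
      hg.condExp_ae_eq (Nat.le_succ j), hg.condExp_ae_eq (le_refl j)] with ω a b c
    rw [a, Pi.sub_apply, b, c, sub_self]; rfl
  have h3 := integral_condExp (μ := μ) (ℱ.le j) (f := X * (g (j + 1) - g j))
  have h4 : (fun ω => X ω * (g (j + 1) ω - g j ω)) = X * (g (j + 1) - g j) := rfl
  rw [h4, ← h3]
  refine integral_eq_zero_of_ae ?_
  filter_upwards [h1, h2] with ω a b
  rw [a, Pi.mul_apply, b]; simp

lemma integral_paraproduct {ℱ : Filtration ℕ m} [IsFiniteMeasure μ] {a g : ℕ → Ω → ℝ}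
    (hg : Martingale g ℱ μ) (ha : StronglyAdapted ℱ a)
    (hi : ∀ j, Integrable (fun ω => a j ω * (g (j + 1) ω - g j ω)) μ) (n : ℕ) :
    ∫ ω, paraproduct a g n ω ∂μ = 0 := by
  unfold paraproduct
  rw [integral_finsetSum _ fun j _ => hi j]
  exact Finset.sum_eq_zero fun j _ => integral_mul_martingale_sub hg (ha j) (hi j)

lemma martingale_paraproduct {ℱ : Filtration ℕ m} [IsFiniteMeasure μ] {a g : ℕ → Ω → ℝ}
    (hg : Martingale g ℱ μ) (ha : StronglyAdapted ℱ a)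
    (hi : ∀ j, Integrable (fun ω => a j ω * (g (j + 1) ω - g j ω)) μ) :
    Martingale (paraproduct a g) ℱ μ := by
  have hint : ∀ n, Integrable (paraproduct a g n) μ := fun n => by
    unfold paraproduct
    exact integrable_finsetSum _ fun j _ => hi j
  refine martingale_nat (paraproduct_stronglyAdapted ha hg.stronglyAdapted) hint fun n => ?_
  have e : paraproduct a g (n + 1) = paraproduct a g n + a n * (g (n + 1) - g n) := by
    ext ω; exact paraproduct_succ a g n ω
  have hd : Integrable (g (n + 1) - g n) μ := (hg.integrable _).sub (hg.integrable _)
  rw [e]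
  filter_upwards [condExp_add (hint n) (hi n) (ℱ n),
    condExp_mul_of_stronglyMeasurable_left (μ := μ) (ha n) (g := g (n + 1) - g n) (hi n) hd,
    condExp_sub (hg.integrable (n + 1)) (hg.integrable n) (ℱ n),
    hg.condExp_ae_eq (Nat.le_succ n), hg.condExp_ae_eq (le_refl n)] with ω h1 h2 h3 h4 h5
  have h6 := condExp_of_stronglyMeasurable (ℱ.le n)
    (paraproduct_stronglyAdapted ha hg.stronglyAdapted n) (hint n)
  have h7 : (μ[paraproduct a g n + a n * (g (n + 1) - g n) | ℱ n]) ω =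
      (μ[paraproduct a g n | ℱ n]) ω + (μ[a n * (g (n + 1) - g n) | ℱ n]) ω := h1
  rw [h7, h6, h2, Pi.mul_apply, h3, Pi.sub_apply, h4, h5]
  simp

end Transforms

end

noncomputable section

/-! ### Doob's maximal inequality and the compensator of a nonnegative supermartingale -/

section Doob

variable {Ω : Type*} {m : MeasurableSpace Ω} {μ : Measure Ω}

/-- The sign of a real number, with value `1` at `0`. -/
def sgn (x : ℝ) : ℝ := if 0 ≤ x then 1 else -1

lemma measurable_sgn : Measurable sgn :=
  Measurable.ite measurableSet_Ici measurable_const measurable_const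

lemma abs_sgn (x : ℝ) : |sgn x| = 1 := by unfold sgn; split_ifs <;> simp

/-- Subgradient inequality for the absolute value at x. -/
lemma sgn_mul_sub_le (x y : ℝ) : sgn x * (y - x) ≤ |y| - |x| := by
  unfold sgn
  split_ifs with h
  · rw [abs_of_nonneg h]; linarith [le_abs_self y]
  · rw [abs_of_neg (not_le.1 h)]; linarith [neg_abs_le y]

lemma holderTriple_conj {p : ℝ} (hp : 1 < p) : (p / (p - 1)).HolderTriple p 1 := by
  have hp1 : 0 < p - 1 := by linarith
  exact ⟨by rw [inv_div]; field_simp; ring, by positivity, by linarith⟩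

lemma integrable_of_inLp_one {X : Ω → ℝ} (h : InLp μ 1 X) : Integrable X μ := by
  rw [InLp, ENNReal.ofReal_one] at h
  exact memLp_one_iff_integrable.1 h

/-- Young's inequality with exponents p and p/(p-1). It handles the jumps of the running maximum in
Doob's inequality and also yields the convexity bound `rpow_sub_rpow_le`. -/
lemma rpow_young {p a b : ℝ} (hp : 1 < p) (ha : 0 ≤ a) (hb : 0 ≤ b) :
    a ^ (p - 1) * b ≤ b ^ p / p + (p - 1) / p * a ^ p := by
  have hp1 : 0 < p - 1 := by linarith
  have hc : p.HolderConjugate (p / (p - 1)) := (holderTriple_conj hp).symm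
  have := Real.young_inequality_of_nonneg hb (Real.rpow_nonneg ha (p - 1)) hc
  rw [← Real.rpow_mul ha, mul_div_cancel₀ _ hp1.ne'] at this
  calc _ = b * a ^ (p - 1) := mul_comm _ _
    _ ≤ _ := this
    _ = _ := by field_simp

/-- A pathwise form of Doob's inequality. -/
lemma runMax_rpow_le {p : ℝ} (hp : 1 < p) (g : ℕ → Ω → ℝ) (n : ℕ) (ω : Ω) :
    (p - 1) / p * runMax g n ω ^ p ≤ runMax g n ω ^ (p - 1) * |g n ω|
      - paraproduct (fun j ω => runMax g j ω ^ (p - 1) * sgn (g j ω)) g n ω := by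
  have hp0 : 0 < p := by linarith
  have split : ∀ x : ℝ, 0 ≤ x → x ^ (p - 1) * x = x ^ p := fun x hx => by
    rw [← Real.rpow_add_one' hx (by simpa using hp0.ne')]; simp
  induction n with
  | zero =>
    simp only [runMax, paraproduct_zero, sub_zero]
    rw [split _ (abs_nonneg _)]
    have h0 := Real.rpow_nonneg (abs_nonneg (g 0 ω)) p
    have h1 : (p - 1) / p ≤ 1 := by rw [div_le_one hp0]; linarith
    exact mul_le_of_le_one_left h0 h1
  | succ n ih =>
    rw [paraproduct_succ]
    have hm := runMax_nonneg g n ω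
    have hA := Real.rpow_nonneg hm (p - 1)
    have hs := mul_le_mul_of_nonneg_left (sgn_mul_sub_le (g n ω) (g (n + 1) ω)) hA
    -- If the maximum does not move, the subgradient inequality suffices; if it jumps to |g (n+1)|,
    -- Young's inequality pays for the jump.
    rcases le_or_gt |g (n + 1) ω| (runMax g n ω) with h | h
    · have e : runMax g (n + 1) ω = runMax g n ω := max_eq_left h
      rw [e]
      nlinarith
    · have e : runMax g (n + 1) ω = |g (n + 1) ω| := max_eq_right h.le
      rw [e, split _ (abs_nonneg _)]
      have hy := rpow_young hp hm (abs_nonneg (g (n + 1) ω))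
      have hdiv : (p - 1) / p * |g (n + 1) ω| ^ p
          = |g (n + 1) ω| ^ p - |g (n + 1) ω| ^ p / p := by field_simp
      rw [hdiv]
      nlinarith

/-- **Doob's `L^p` maximal inequality**. -/
theorem lpn_runMax_le {ℱ : Filtration ℕ m} [IsFiniteMeasure μ] {p : ℝ} (hp : 1 < p)
    {g : ℕ → Ω → ℝ} (hg : Martingale g ℱ μ) (hgp : ∀ n, InLp μ p (g n)) (n : ℕ) :
    lpn μ p (runMax g n) ≤ ENNReal.ofReal (p / (p - 1)) * lpn μ p (g n) := by
  have hp0 : 0 < p := by linarith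
  have hp1 : 0 < p - 1 := by linarith
  set a : ℕ → Ω → ℝ := fun j ω => runMax g j ω ^ (p - 1) * sgn (g j ω) with ha
  have hM : ∀ j, InLp μ p (runMax g j) := InLp.runMax hgp
  have hMr : ∀ j, InLp μ (p / (p - 1)) (fun ω => runMax g j ω ^ (p - 1)) := fun j =>
    InLp.rpow hp1 (runMax_nonneg g j) (hM j)
  have had : StronglyAdapted ℱ a := fun j =>
    (((runMax_stronglyAdapted hg.stronglyAdapted j).measurable.pow_const _).mul
      (measurable_sgn.comp (hg.stronglyAdapted j).measurable)).stronglyMeasurable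
  have haL : ∀ j, InLp μ (p / (p - 1)) (a j) := fun j => by
    refine (hMr j).mono (StronglyAdapted.aesm had j) (ae_of_all _ fun ω => ?_)
    rw [ha, abs_mul, abs_sgn, mul_one, abs_of_nonneg (Real.rpow_nonneg (runMax_nonneg g j ω) _)]
  have hT := holderTriple_conj hp
  have hi : ∀ j, Integrable (fun ω => a j ω * (g (j + 1) ω - g j ω)) μ := fun j =>
    integrable_of_inLp_one (InLp.mul hT (haL j) ((hgp (j + 1)).sub (hgp j)))
  rw [← lpn_abs p (g n)]
  have hgn : InLp μ p (fun ω => |g n ω|) := (hgp n).norm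
  have hc : 0 ≤ p / (p - 1) := by positivity
  refine lpn_le_of_integral_rpow_le (X := runMax g n) (Y := fun ω => |g n ω|) hp hc
    (runMax_nonneg g n) (fun ω => abs_nonneg (g n ω)) (hM n) hgn ?_
  have hi1 : Integrable (fun ω => runMax g n ω ^ p) μ := by
    have := InLp.rpow hp0 (runMax_nonneg g n) (hM n)
    rw [div_self hp0.ne'] at this
    exact integrable_of_inLp_one this
  have hi2 : Integrable (fun ω => runMax g n ω ^ (p - 1) * |g n ω|) μ :=
    integrable_of_inLp_one (InLp.mul hT (hMr n) hgn)
  have hi3 : Integrable (paraproduct a g n) μ := by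
    unfold paraproduct
    exact integrable_finsetSum _ fun j _ => hi j
  have h := integral_mono (hi1.const_mul ((p - 1) / p)) (hi2.sub hi3)
    (runMax_rpow_le hp g n)
  have h2 : ∫ ω, ((fun ω => runMax g n ω ^ (p - 1) * |g n ω|) - paraproduct a g n) ω ∂μ
      = ∫ ω, runMax g n ω ^ (p - 1) * |g n ω| ∂μ := by
    rw [integral_sub' hi2 hi3, integral_paraproduct hg had hi n, sub_zero]
  rw [h2, integral_const_mul] at h
  calc ∫ ω, runMax g n ω ^ p ∂μ
      = p / (p - 1) * ((p - 1) / p * ∫ ω, runMax g n ω ^ p ∂μ) := by field_simp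
    _ ≤ _ := by gcongr

/-! ### Compensators of nonnegative supermartingales -/

/-- The compensator of a supermartingale `u`: the increasing part of its Doob decomposition. -/
def compensator (u : ℕ → Ω → ℝ) (ℱ : Filtration ℕ m) (μ : Measure Ω) (n : ℕ) (ω : Ω) : ℝ :=
  -predictablePart u ℱ μ n ω

lemma martingalePart_eq_add_compensator (u : ℕ → Ω → ℝ) (ℱ : Filtration ℕ m) (μ : Measure Ω)
    (n : ℕ) (ω : Ω) : martingalePart u ℱ μ n ω = u n ω + compensator u ℱ μ n ω := by
  simp [martingalePart, compensator, sub_eq_add_neg]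

lemma compensator_zero (u : ℕ → Ω → ℝ) (ℱ : Filtration ℕ m) (μ : Measure Ω) (ω : Ω) :
    compensator u ℱ μ 0 ω = 0 := by
  simp [compensator]

lemma stronglyMeasurable_compensator_succ (u : ℕ → Ω → ℝ) (ℱ : Filtration ℕ m) (μ : Measure Ω)
    (n : ℕ) : StronglyMeasurable[ℱ n] (compensator u ℱ μ (n + 1)) :=
  (stronglyAdapted_predictablePart (f := u) (ℱ := ℱ) (μ := μ) n).neg

lemma compensator_monotone {ℱ : Filtration ℕ m} [IsFiniteMeasure μ] {u : ℕ → Ω → ℝ}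
    (hu : Supermartingale u ℱ μ) : ∀ᵐ ω ∂μ, Monotone fun n => compensator u ℱ μ n ω := by
  have : ∀ n, ∀ᵐ ω ∂μ, compensator u ℱ μ n ω ≤ compensator u ℱ μ (n + 1) ω := fun n => by
    filter_upwards [condExp_sub (hu.integrable (n + 1)) (hu.integrable n) (ℱ n),
      hu.condExp_ae_le n.le_succ] with ω h1 h2
    have h3 := condExp_of_stronglyMeasurable (ℱ.le n) (hu.stronglyAdapted n) (hu.integrable n)
    rw [Pi.sub_apply, h3] at h1
    simp only [compensator, predictablePart_add_one, Pi.add_apply, h1]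
    linarith
  filter_upwards [ae_all_iff.2 this] with ω h
  exact monotone_nat_of_le_succ h

lemma InLp.compensator {ℱ : Filtration ℕ m} [IsFiniteMeasure μ] {u : ℕ → Ω → ℝ} {s : ℝ}
    (hs : 1 < s) (hu : ∀ n, InLp μ s (u n)) (n : ℕ) : InLp μ s (compensator u ℱ μ n) := by
  refine MemLp.neg (f := predictablePart u ℱ μ n) ?_
  induction n with
  | zero => simp only [predictablePart_zero]; exact MemLp.zero
  | succ n ih =>
    rw [predictablePart_add_one]
    exact ih.add (MemLp.condExp (by simpa using hs.le) ((hu (n + 1)).sub (hu n)))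

/-- Convexity of the power, with the tangent at the larger endpoint. The weight then involves B at
time j + 1, which is already known at time j when B is predictable. -/
lemma rpow_sub_rpow_le {s a b : ℝ} (hs : 1 < s) (ha : 0 ≤ a) (hab : a ≤ b) :
    b ^ s - a ^ s ≤ s * (b ^ (s - 1) * (b - a)) := by
  have hb := ha.trans hab
  have hs0 : 0 < s := by linarith
  have h := rpow_young hs hb ha
  have e : b ^ (s - 1) * b = b ^ s := by
    rw [← Real.rpow_add_one' hb (by simpa using hs0.ne')]; simp
  have h' := mul_le_mul_of_nonneg_left h hs0.le
  have e2 : s * (a ^ s / s + (s - 1) / s * b ^ s) = a ^ s + (s - 1) * b ^ s := by field_simp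
  rw [e2] at h'
  nlinarith

/-- Pathwise estimate for the increasing part of a Doob decomposition. -/
lemma increasing_rpow_le {s : ℝ} (hs : 1 < s) {u B : ℕ → Ω → ℝ} {ω : Ω}
    (hB : Monotone fun n => B n ω) (hB0 : B 0 ω = 0) (n : ℕ) :
    |B n ω| ^ s ≤ s * (|B n ω| ^ (s - 1) * runMax u n ω - |B n ω| ^ (s - 1) * u n ω
      + paraproduct (fun j ω => |B (j + 1) ω| ^ (s - 1)) (fun j ω => u j ω + B j ω) n ω) := by
  have hs0 : 0 < s := by linarith
  have hs1 : 0 < s - 1 := by linarith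
  have hBn : ∀ n, 0 ≤ B n ω := fun n => hB0 ▸ hB (Nat.zero_le n)
  induction n with
  | zero =>
    simp [hB0, Real.zero_rpow hs0.ne', Real.zero_rpow hs1.ne']
  | succ n ih =>
    rw [paraproduct_succ]
    have hstep := hB n.le_succ
    simp only [abs_of_nonneg (hBn _)] at ih ⊢
    have h1 := rpow_sub_rpow_le hs (hBn n) hstep
    have h2 : B n ω ^ (s - 1) ≤ B (n + 1) ω ^ (s - 1) := by
      exact Real.rpow_le_rpow (hBn n) hstep hs1.le
    have h3 : runMax u n ω ≤ runMax u (n + 1) ω := runMax_mono u ω n.le_succ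
    have h4 : u n ω ≤ runMax u n ω := (le_abs_self _).trans (abs_le_runMax_self u n ω)
    have h5 : 0 ≤ B (n + 1) ω ^ (s - 1) := Real.rpow_nonneg (hBn _) _
    -- Summation by parts: the difference of the maximum and u is nonnegative, so its increasing
    -- weight may be raised to time n + 1.
    have h6 : B n ω ^ (s - 1) * (runMax u n ω - u n ω)
        ≤ B (n + 1) ω ^ (s - 1) * (runMax u (n + 1) ω - u n ω) :=
      mul_le_mul h2 (by linarith) (by linarith) h5
    have h7 : B (n + 1) ω ^ s ≤ s * (B n ω ^ (s - 1) * runMax u n ω - B n ω ^ (s - 1) * u n ω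
        + paraproduct (fun j ω => |B (j + 1) ω| ^ (s - 1)) (fun j ω => u j ω + B j ω) n ω
        + (B (n + 1) ω ^ (s - 1) * (B (n + 1) ω - B n ω))) := by linarith
    refine h7.trans (mul_le_mul_of_nonneg_left ?_ hs0.le)
    linarith

/-- The increasing part of a nonnegative supermartingale is controlled by its maximum. -/
theorem lpn_compensator_le {ℱ : Filtration ℕ m} [IsFiniteMeasure μ] {s : ℝ} (hs : 1 < s)
    {u : ℕ → Ω → ℝ} (hu : Supermartingale u ℱ μ) (hu0 : ∀ n ω, 0 ≤ u n ω)
    (hus : ∀ n, InLp μ s (u n)) (n : ℕ) :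
    lpn μ s (compensator u ℱ μ n) ≤ ENNReal.ofReal s * lpn μ s (runMax u n) := by
  have hs0 : 0 < s := by linarith
  have hs1 : 0 < s - 1 := by linarith
  set B := compensator u ℱ μ with hBdef
  -- The index j + 1 keeps `a` adapted because B is predictable. The absolute value is there because
  -- B is nonnegative only almost everywhere.
  set a : ℕ → Ω → ℝ := fun j ω => |B (j + 1) ω| ^ (s - 1) with ha
  have hB : ∀ j, InLp μ s (B j) := InLp.compensator hs hus
  have hBa : ∀ j, InLp μ s (fun ω => |B j ω|) := fun j => (hB j).norm
  have hBr : ∀ j, InLp μ (s / (s - 1)) (fun ω => |B j ω| ^ (s - 1)) := fun j =>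
    InLp.rpow hs1 (fun ω => abs_nonneg _) (hBa j)
  have hM : Martingale (fun j ω => u j ω + B j ω) ℱ μ := by
    have := martingale_martingalePart (f := u) (ℱ := ℱ) (μ := μ) hu.stronglyAdapted hu.integrable
    have e : martingalePart u ℱ μ = fun j ω => u j ω + B j ω := by
      ext j ω; exact martingalePart_eq_add_compensator u ℱ μ j ω
    rwa [e] at this
  have had : StronglyAdapted ℱ a := fun j =>
    ((stronglyMeasurable_compensator_succ u ℱ μ j).norm.measurable.pow_const
      (s - 1)).stronglyMeasurable
  have hT := holderTriple_conj hs
  have hML : ∀ j, InLp μ s (fun ω => u j ω + B j ω) := fun j => (hus j).add (hB j)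
  have hi : ∀ j, Integrable (fun ω => a j ω * ((u (j + 1) ω + B (j + 1) ω)
      - (u j ω + B j ω))) μ := fun j =>
    integrable_of_inLp_one (InLp.mul hT (hBr (j + 1)) ((hML (j + 1)).sub (hML j)))
  rw [← lpn_abs s (B n)]
  have hR := InLp.runMax hus n
  refine lpn_le_of_integral_rpow_le (X := fun ω => |B n ω|) (Y := runMax u n) hs hs0.le
    (fun ω => abs_nonneg (B n ω)) (runMax_nonneg u n) (hBa n) hR ?_
  have hi1 : Integrable (fun ω => |B n ω| ^ s) μ := by
    have := InLp.rpow hs0 (fun ω => abs_nonneg _) (hBa n)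
    rw [div_self hs0.ne'] at this
    exact integrable_of_inLp_one this
  have hi2 : Integrable (fun ω => |B n ω| ^ (s - 1) * runMax u n ω) μ :=
    integrable_of_inLp_one (InLp.mul hT (hBr n) hR)
  have hi3 : Integrable (paraproduct a (fun j ω => u j ω + B j ω) n) μ := by
    unfold paraproduct
    exact integrable_finsetSum _ fun j _ => hi j
  have h : ∫ ω, |B n ω| ^ s ∂μ ≤ ∫ ω, s * ((fun ω => |B n ω| ^ (s - 1) * runMax u n ω)
      + paraproduct a (fun j ω => u j ω + B j ω) n) ω ∂μ := by
    refine integral_mono_ae hi1 ((hi2.add hi3).const_mul s) ?_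
    filter_upwards [compensator_monotone hu] with ω hω
    refine (increasing_rpow_le (u := u) hs hω (compensator_zero u ℱ μ ω) n).trans ?_
    -- Nonnegativity of u allows the term -B^(s-1) u to be dropped.
    have h0 : 0 ≤ |B n ω| ^ (s - 1) * u n ω :=
      mul_nonneg (Real.rpow_nonneg (abs_nonneg _) _) (hu0 n ω)
    simp only [Pi.add_apply]
    gcongr
    linarith
  rwa [integral_const_mul, integral_add' hi2 hi3, integral_paraproduct hM had hi n,
    add_zero] at h

end Doob

end

noncomputable section

/-! ### Transforms of martingales in `L^q`, `q > 2` -/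

section TransformBound

/-- Hypotheses for the transform of the martingale `g` by the adapted coefficients `a`, which are
dominated by the increasing adapted process `A`. -/
structure TransformData {Ω : Type*} {m : MeasurableSpace Ω} (μ : Measure Ω) (ℱ : Filtration ℕ m)
    (p q : ℝ) (g a A : ℕ → Ω → ℝ) : Prop where
  martingale : Martingale g ℱ μ
  inLp_g : ∀ n, InLp μ q (g n)
  adapted_a : StronglyAdapted ℱ a
  adapted_A : StronglyAdapted ℱ A
  mono : ∀ ω, Monotone fun n => A n ω
  abs_le : ∀ n ω, |a n ω| ≤ A n ω
  inLp_A : ∀ n, InLp μ p (A n)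

/-- The maximal `L^r` bound for transforms of `L^q` martingales by coefficients
with maximal function in `L^p`. -/
def TransformBound.{u} (p q r : ℝ) : Prop :=
  ∃ C : ℝ≥0, ∀ (Ω : Type u) (m : MeasurableSpace Ω) (μ : Measure Ω) (_ : IsProbabilityMeasure μ)
    (ℱ : Filtration ℕ m) (g a A : ℕ → Ω → ℝ), TransformData μ ℱ p q g a A →
    ∀ n, lpn μ r (runMax (paraproduct a g) n) ≤ C * (lpn μ p (A n) * lpn μ q (runMax g n))

variable {Ω : Type*} {m : MeasurableSpace Ω} {μ : Measure Ω} {ℱ : Filtration ℕ m} {p q r : ℝ}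
  {g a A : ℕ → Ω → ℝ}

namespace TransformData

lemma nonneg (h : TransformData μ ℱ p q g a A) (n : ℕ) (ω : Ω) : 0 ≤ A n ω :=
  (abs_nonneg _).trans (h.abs_le n ω)

lemma aesm_A (h : TransformData μ ℱ p q g a A) (n : ℕ) : AEStronglyMeasurable (A n) μ :=
  (h.inLp_A n).1

lemma inLp_a (h : TransformData μ ℱ p q g a A) (n : ℕ) : InLp μ p (a n) :=
  (h.inLp_A n).mono (StronglyAdapted.aesm h.adapted_a n) (ae_of_all _ (h.abs_le n))

lemma inLp_paraproduct (h : TransformData μ ℱ p q g a A) (hT : p.HolderTriple q r) (n : ℕ) :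
    InLp μ r (paraproduct a g n) :=
  InLp.paraproduct hT h.inLp_a h.inLp_g n

lemma inLp_runMax (h : TransformData μ ℱ p q g a A) (n : ℕ) : InLp μ q (runMax g n) :=
  InLp.runMax h.inLp_g n

end TransformData

lemma runMax_paraproduct_aesm (ha : StronglyAdapted ℱ a) (hg : StronglyAdapted ℱ g) (n : ℕ) :
    AEStronglyMeasurable (runMax (paraproduct a g) n) μ :=
  StronglyAdapted.aesm (runMax_stronglyAdapted (paraproduct_stronglyAdapted ha hg)) n

/-! ### Energy identities for transforms, and the exponent changes for q > 2 -/

/-- Weighted sum of squared increments. -/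
def weightedSq (w g : ℕ → Ω → ℝ) (n : ℕ) (ω : Ω) : ℝ :=
  ∑ j ∈ Finset.range n, w j ω * (g (j + 1) ω - g j ω) ^ 2

lemma weightedSq_succ (w g : ℕ → Ω → ℝ) (n : ℕ) (ω : Ω) :
    weightedSq w g (n + 1) ω = weightedSq w g n ω + w n ω * (g (n + 1) ω - g n ω) ^ 2 := by
  simp [weightedSq, Finset.sum_range_succ]

lemma weightedSq_le_weightedSq {w v : ℕ → Ω → ℝ} (g : ℕ → Ω → ℝ) {ω : Ω} {n : ℕ}
    (h : ∀ j, w j ω ≤ v j ω) : weightedSq w g n ω ≤ weightedSq v g n ω :=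
  Finset.sum_le_sum fun j _ => mul_le_mul_of_nonneg_right (h j) (sq_nonneg _)

/-- Each squared increment equals the increment of g² minus 2 g times the increment of g; the first
contribution is summed by parts against the increasing weight. -/
lemma weightedSq_le {w : ℕ → Ω → ℝ} (g : ℕ → Ω → ℝ) {ω : Ω} (hw : Monotone fun n => w n ω)
    (hw0 : 0 ≤ w 0 ω) (n : ℕ) :
    weightedSq w g n ω ≤ w n ω * g n ω ^ 2 - 2 * paraproduct (fun j ω => w j ω * g j ω) g n ω := by
  induction n with
  | zero => simp only [weightedSq, Finset.range_zero, Finset.sum_empty, paraproduct_zero]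
            have := mul_nonneg hw0 (sq_nonneg (g 0 ω))
            linarith
  | succ n ih =>
    rw [weightedSq_succ, paraproduct_succ]
    have := mul_le_mul_of_nonneg_right (hw n.le_succ) (sq_nonneg (g (n + 1) ω))
    nlinarith

lemma paraproduct_sq (a g : ℕ → Ω → ℝ) (n : ℕ) (ω : Ω) :
    paraproduct a g n ω ^ 2 = weightedSq (fun j ω => a j ω ^ 2) g n ω
      + 2 * paraproduct (fun j ω => paraproduct a g j ω * a j ω) g n ω := by
  induction n with
  | zero => simp [weightedSq]
  | succ n ih =>
    rw [weightedSq_succ, paraproduct_succ, paraproduct_succ, add_sq, ih]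
    ring

/-- The quadratic identity behind all upward steps. -/
lemma paraproduct_sq_le {ω : Ω} (hA : Monotone fun n => A n ω) (h : ∀ n, |a n ω| ≤ A n ω)
    (n : ℕ) :
    paraproduct a g n ω ^ 2 ≤ (A n ω * g n ω) ^ 2
      - 2 * paraproduct (fun j ω => A j ω * (A j ω * g j ω)) g n ω
      + 2 * paraproduct (fun j ω => paraproduct a g j ω * a j ω) g n ω := by
  have hA0 : ∀ n, 0 ≤ A n ω := fun n => (abs_nonneg _).trans (h n)
  have hm : Monotone fun n => A n ω ^ 2 := fun i j hij => pow_le_pow_left₀ (hA0 i) (hA hij) 2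
  have h1 : weightedSq (fun j ω => a j ω ^ 2) g n ω ≤ weightedSq (fun j ω => A j ω ^ 2) g n ω :=
    weightedSq_le_weightedSq g fun j => by
      rw [← sq_abs]; exact pow_le_pow_left₀ (abs_nonneg _) (h j) 2
  have h2 := weightedSq_le (w := fun j ω => A j ω ^ 2) g hm (sq_nonneg _) n
  have e : (fun j ω => A j ω ^ 2 * g j ω) = fun j ω => A j ω * (A j ω * g j ω) := by
    ext; ring
  rw [e] at h2
  rw [paraproduct_sq, mul_pow]
  linarith

lemma ennreal_le_of_sq_le {x y : ℝ≥0∞} (h : x ^ 2 ≤ y ^ 2) : x ≤ y := by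
  by_contra! hc
  exact absurd h (not_le.2 (ENNReal.pow_lt_pow_left two_ne_zero hc))

/-- Either x ≤ G, or G² ≤ xG and a factor x can be cancelled. Finiteness of x is essential for the
cancellation; in the application it comes from Hölder. -/
lemma ennreal_absorb {x G : ℝ≥0∞} {D : ℝ≥0} (hx : x ≠ ∞) (h : x ^ 2 ≤ D * (G ^ 2 + x * G)) :
    x ≤ (1 + 2 * D : ℝ≥0) * G := by
  push_cast
  rcases le_total x G with hG | hG
  · calc x ≤ 1 * G := by rwa [one_mul]
      _ ≤ _ := by gcongr; exact le_self_add
  · by_cases h0 : x = 0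
    · simp [h0]
    have h1 : x * x ≤ x * (2 * D * G) := by
      calc x * x = x ^ 2 := (sq x).symm
        _ ≤ D * (G ^ 2 + x * G) := h
        _ ≤ D * (x * G + x * G) := by rw [sq]; gcongr
        _ = _ := by ring
    have h2 : x ≤ 2 * D * G := (ENNReal.mul_le_mul_iff_right h0 hx).1 h1
    exact h2.trans (by gcongr; exact le_add_self)

/-- The `L²` bound for transforms. -/
lemma transformBound_two (hT : p.HolderTriple q 2) : TransformBound p q 2 := by
  refine ⟨2, fun Ω m μ _ ℱ g a A h n => ?_⟩
  have h22 : (2 : ℝ).HolderTriple 2 1 := ⟨by norm_num, two_pos, two_pos⟩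
  set N := paraproduct a g with hN
  have hNL : ∀ j, InLp μ 2 (N j) := h.inLp_paraproduct hT
  have hAg : ∀ j, InLp μ 2 (fun ω => A j ω * g j ω) := fun j =>
    InLp.mul hT (h.inLp_A j) (h.inLp_g j)
  have hd : ∀ j, InLp μ q (fun ω => g (j + 1) ω - g j ω) := fun j =>
    (h.inLp_g (j + 1)).sub (h.inLp_g j)
  have had : ∀ j, InLp μ 2 (fun ω => a j ω * (g (j + 1) ω - g j ω)) := fun j =>
    InLp.mul hT (h.inLp_a j) (hd j)
  have hAd : ∀ j, InLp μ 2 (fun ω => A j ω * (g (j + 1) ω - g j ω)) := fun j =>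
    InLp.mul hT (h.inLp_A j) (hd j)
  have one_le : (1 : ℝ≥0∞) ≤ ENNReal.ofReal 2 := by simp
  have hNm : Martingale N ℱ μ := martingale_paraproduct h.martingale h.adapted_a fun j =>
    (had j).integrable one_le
  have hgad := h.martingale.stronglyAdapted
  -- Regrouped as (A g) times (A times the increment of g), a product of two L² functions; `i2`
  -- regroups in the same way.
  have i1 : ∀ j, Integrable (fun ω => A j ω * (A j ω * g j ω) * (g (j + 1) ω - g j ω)) μ :=
    fun j => by
      have := integrable_of_inLp_one (InLp.mul h22 (hAg j) (hAd j))
      refine this.congr (ae_of_all _ fun ω => ?_)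
      ring
  have i2 : ∀ j, Integrable (fun ω => N j ω * a j ω * (g (j + 1) ω - g j ω)) μ :=
    fun j => by
      have := integrable_of_inLp_one (InLp.mul h22 (hNL j) (had j))
      refine this.congr (ae_of_all _ fun ω => ?_)
      ring
  have e1 := integral_paraproduct (a := fun j ω => A j ω * (A j ω * g j ω)) h.martingale
    (fun j => (h.adapted_A j).mul ((h.adapted_A j).mul (hgad j))) i1 n
  have e2 := integral_paraproduct (a := fun j ω => N j ω * a j ω) h.martingale
    (fun j => (hNm.stronglyAdapted j).mul (h.adapted_a j)) i2 n
  have j1 : Integrable (paraproduct (fun j ω => A j ω * (A j ω * g j ω)) g n) μ := by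
    unfold paraproduct; exact integrable_finsetSum _ fun j _ => i1 j
  have j2 : Integrable (paraproduct (fun j ω => N j ω * a j ω) g n) μ := by
    rw [show paraproduct (fun j ω => N j ω * a j ω) g n = fun ω => ∑ j ∈ Finset.range n,
      (fun j ω => N j ω * a j ω) j ω * (g (j + 1) ω - g j ω) from rfl]
    exact integrable_finsetSum _ fun j _ => i2 j
  have sqi : ∀ {X : Ω → ℝ}, InLp μ 2 X → Integrable (fun ω => X ω ^ 2) μ := fun hX => by
    have := InLp.sq hX
    rw [div_self two_ne_zero] at this
    exact integrable_of_inLp_one this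
  have hint : ∫ ω, N n ω ^ 2 ∂μ ≤ ∫ ω, (A n ω * g n ω) ^ 2 ∂μ := by
    have := integral_mono (sqi (hNL n)) (((sqi (hAg n)).sub (j1.const_mul 2)).add (j2.const_mul 2))
      (fun ω => paraproduct_sq_le (g := g) (h.mono ω) (fun n => h.abs_le n ω) n)
    rw [integral_add' ((sqi (hAg n)).sub (j1.const_mul 2)) (j2.const_mul 2),
      integral_sub' (sqi (hAg n)) (j1.const_mul 2), integral_const_mul, integral_const_mul,
      e1, e2] at this
    linarith
  have hsq : lpn μ 2 (N n) ^ 2 ≤ lpn μ 2 (fun ω => A n ω * g n ω) ^ 2 := by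
    rw [← lpn_sq, ← lpn_sq, div_self two_ne_zero, lpn_one_eq (fun ω => sq_nonneg _) (sqi (hNL n)),
      lpn_one_eq (fun ω => sq_nonneg _) (sqi (hAg n))]
    exact ENNReal.ofReal_le_ofReal hint
  have hdoob := lpn_runMax_le one_lt_two hNm hNL n
  calc lpn μ 2 (runMax N n) ≤ ENNReal.ofReal (2 / (2 - 1)) * lpn μ 2 (N n) := hdoob
    _ ≤ (2 : ℝ≥0) * (lpn μ p (A n) * lpn μ q (g n)) := by
      gcongr
      · norm_num
      · exact (ennreal_le_of_sq_le hsq).trans (lpn_mul_le hT (h.inLp_A n).1 (h.inLp_g n).1)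
    _ ≤ _ := by
      gcongr
      exact lpn_mono (ae_of_all _ (abs_le_runMax_self g n))

/-- The doubling step: a bound at `r / 2` yields a bound at `r`. -/
lemma TransformBound.double {p' : ℝ} (hT : p.HolderTriple q r) (hT' : p'.HolderTriple q (r / 2))
    (hB : TransformBound.{u} p' q (r / 2)) : TransformBound.{u} p q r := by
  obtain ⟨C, hC⟩ := hB
  set K := addConst (r / 2) with hK
  refine ⟨1 + 2 * (K * (1 + 2 * (K * C))), fun Ω m μ _ ℱ g a A h n => ?_⟩
  have hr := hT.pos'
  -- The new coefficients A·A·g and Π(a, g)·a are products of an L^r and an L^p function, hence lie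
  -- in L^{p'}, as required at the exponent r/2.
  have hrp : r.HolderTriple p p' := ⟨by
    have h1 := hT.inv_eq
    have h2 := hT'.inv_eq
    rw [inv_div, div_eq_mul_inv, h1] at h2
    rw [h1]; linarith, hr, hT.pos⟩
  have hgad := h.martingale.stronglyAdapted
  set N := paraproduct a g with hN
  have hNad : StronglyAdapted ℱ N := paraproduct_stronglyAdapted h.adapted_a hgad
  have hNL : ∀ j, InLp μ r (N j) := h.inLp_paraproduct hT
  have hNR : ∀ j, InLp μ r (runMax N j) := InLp.runMax hNL
  set a₁ : ℕ → Ω → ℝ := fun j ω => A j ω * (A j ω * g j ω)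
  set a₂ : ℕ → Ω → ℝ := fun j ω => N j ω * a j ω
  set G := lpn μ p (A n) * lpn μ q (runMax g n) with hG
  have hAg : ∀ j, InLp μ r (fun ω => A j ω * runMax g j ω) := fun j =>
    InLp.mul hT (h.inLp_A j) (h.inLp_runMax j)
  have had : StronglyAdapted ℱ a₁ := fun j =>
    (h.adapted_A j).mul ((h.adapted_A j).mul (hgad j))
  have had' : StronglyAdapted ℱ a₂ := fun j => (hNad j).mul (h.adapted_a j)
  have d₁ : TransformData μ ℱ p' q g a₁ (fun j ω => A j ω * runMax g j ω * A j ω) :=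
    { martingale := h.martingale
      inLp_g := h.inLp_g
      adapted_a := had
      adapted_A := fun j =>
        ((h.adapted_A j).mul (runMax_stronglyAdapted hgad j)).mul (h.adapted_A j)
      mono := fun ω i j hij => by
        have := h.nonneg i ω
        have := h.nonneg j ω
        have := runMax_nonneg g i ω
        have := runMax_nonneg g j ω
        have := h.mono ω hij
        have := runMax_mono g ω hij
        dsimp only at *
        gcongr
      abs_le := fun j ω => by
        have := h.nonneg j ω
        simp only [a₁, abs_mul, abs_of_nonneg this]
        rw [mul_comm (A j ω)]
        gcongr
        exact abs_le_runMax_self g j ω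
      inLp_A := fun j => InLp.mul hrp (hAg j) (h.inLp_A j) }
  have d₂ : TransformData μ ℱ p' q g a₂ (fun j ω => runMax N j ω * A j ω) :=
    { martingale := h.martingale
      inLp_g := h.inLp_g
      adapted_a := had'
      adapted_A := fun j => (runMax_stronglyAdapted hNad j).mul (h.adapted_A j)
      mono := fun ω i j hij => by
        have := h.nonneg i ω
        have := runMax_nonneg N j ω
        have := h.mono ω hij
        have := runMax_mono N ω hij
        dsimp only at *
        gcongr
      abs_le := fun j ω => by
        have := runMax_nonneg N j ω
        simp only [a₂, abs_mul]
        gcongr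
        · exact abs_le_runMax_self N j ω
        · exact h.abs_le j ω
      inLp_A := fun j => InLp.mul hrp (hNR j) (h.inLp_A j) }
  have b₁ := hC Ω m μ inferInstance ℱ g a₁ _ d₁ n
  have b₂ := hC Ω m μ inferInstance ℱ g a₂ _ d₂ n
  have m₁ : lpn μ (r / 2) (runMax (paraproduct a₁ g) n) ≤ C * G ^ 2 := by
    refine b₁.trans ?_
    refine mul_le_mul_right ?_ _
    refine (mul_le_mul_left ((lpn_mul_le hrp (hAg n).1 (h.inLp_A n).1).trans
      (mul_le_mul_left (lpn_mul_le hT (h.inLp_A n).1 (h.inLp_runMax n).1) _)) _).trans ?_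
    rw [hG]
    apply le_of_eq
    ring
  have m₂ : lpn μ (r / 2) (runMax (paraproduct a₂ g) n) ≤ C * (lpn μ r (runMax N n) * G) := by
    refine b₂.trans ?_
    refine mul_le_mul_right ?_ _
    refine (mul_le_mul_left (lpn_mul_le hrp (hNR n).1 (h.inLp_A n).1) _).trans ?_
    rw [hG]
    apply le_of_eq
    ring
  have path : ∀ ω, runMax N n ω ^ 2 ≤ (A n ω * runMax g n ω) ^ 2
      + (2 : ℝ≥0) * (runMax (paraproduct a₁ g) n ω + runMax (paraproduct a₂ g) n ω) := by
    intro ω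
    have hnn : 0 ≤ (A n ω * runMax g n ω) ^ 2
      + (2 : ℝ≥0) * (runMax (paraproduct a₁ g) n ω + runMax (paraproduct a₂ g) n ω) := by
      have := runMax_nonneg (paraproduct a₁ g) n ω
      have := runMax_nonneg (paraproduct a₂ g) n ω
      positivity
    -- A square root is taken so that the bound on each N i passes to the running maximum before
    -- squaring again.
    refine (Real.le_sqrt (runMax_nonneg N n ω) hnn).1 (runMax_le fun i hi => ?_)
    refine Real.le_sqrt_of_sq_le ?_
    rw [sq_abs]
    have h1 := paraproduct_sq_le (g := g) (h.mono ω) (fun n => h.abs_le n ω) i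
    have h2 : (A i ω * g i ω) ^ 2 ≤ (A n ω * runMax g n ω) ^ 2 := by
      rw [← sq_abs, abs_mul, abs_of_nonneg (h.nonneg i ω)]
      have := h.nonneg i ω
      have h5 := h.mono ω hi
      have h6 := abs_le_runMax g hi ω
      dsimp only at h5
      gcongr
      exact this.trans h5
    have h3 := neg_le_of_abs_le (abs_le_runMax (paraproduct a₁ g) hi ω)
    have h4 := le_of_abs_le (abs_le_runMax (paraproduct a₂ g) hi ω)
    have : ((2 : ℝ≥0) : ℝ) = 2 := rfl
    rw [this]
    change N i ω ^ 2 ≤ _ at h1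
    linarith
  have s₁ := runMax_paraproduct_aesm (μ := μ) had hgad n
  have s₂ := runMax_paraproduct_aesm (μ := μ) had' hgad n
  have main : lpn μ r (runMax N n) ^ 2
      ≤ (K * (1 + 2 * (K * C)) : ℝ≥0) * (G ^ 2 + lpn μ r (runMax N n) * G) := by
    rw [← lpn_sq]
    refine (lpn_mono (ae_of_all _ fun ω => ?_)).trans ((lpn_add_le (r / 2)
      (X := fun ω => (A n ω * runMax g n ω) ^ 2)
      (Y := fun ω => ((2 : ℝ≥0) : ℝ) *
        (runMax (paraproduct a₁ g) n ω + runMax (paraproduct a₂ g) n ω))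
      ((hAg n).1.pow 2) ((s₁.add s₂).const_mul _)).trans ?_)
    · rw [abs_of_nonneg (sq_nonneg _)]; exact path ω
    rw [lpn_sq, lpn_const_mul, ← hK]
    have t₁ : lpn μ r (fun ω => A n ω * runMax g n ω) ≤ G :=
      lpn_mul_le hT (h.inLp_A n).1 (h.inLp_runMax n).1
    have t₂ := lpn_add_le (r / 2) s₁ s₂
    rw [← hK] at t₂
    calc _ ≤ (K : ℝ≥0∞) * (G ^ 2 + (2 : ℝ≥0) *
            (K * (C * G ^ 2 + C * (lpn μ r (runMax N n) * G)))) := by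
          gcongr
          refine t₂.trans ?_
          gcongr
      _ = K * (G ^ 2 + 2 * (K * C) * (G ^ 2 + lpn μ r (runMax N n) * G)) := by
          push_cast; ring
      _ ≤ K * ((G ^ 2 + lpn μ r (runMax N n) * G)
            + 2 * (K * C) * (G ^ 2 + lpn μ r (runMax N n) * G)) := by
          gcongr; exact le_self_add
      _ = _ := by push_cast; ring
  exact ennreal_absorb (hNR n).2.ne main

/-- Summation by parts: Π(w, M) differs from w_n M_n by a sum of the M_j against the nonnegative
increments of w. Each of the two terms costs at most w_n times the maximum of |M|. -/
lemma abs_paraproduct_le_of_monotone {w M : ℕ → Ω → ℝ} {ω : Ω} (hw : Monotone fun n => w n ω)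
    (hw0 : ∀ n, 0 ≤ w n ω) (hM : M 0 ω = 0) (n : ℕ) :
    |paraproduct w M n ω| ≤ 2 * (w n ω * runMax M n ω) := by
  have key : ∀ n, |paraproduct w M n ω - w n ω * M n ω| ≤ w n ω * runMax M n ω := by
    intro n
    induction n with
    | zero => simp [hM, runMax]
    | succ n ih =>
      rw [paraproduct_succ]
      have e : paraproduct w M n ω + w n ω * (M (n + 1) ω - M n ω) - w (n + 1) ω * M (n + 1) ω
          = (paraproduct w M n ω - w n ω * M n ω) - (w (n + 1) ω - w n ω) * M (n + 1) ω := by ring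
      have h0 : 0 ≤ w (n + 1) ω - w n ω := sub_nonneg.2 (hw n.le_succ)
      rw [e]
      refine (abs_sub _ _).trans ?_
      rw [abs_mul, abs_of_nonneg h0]
      have h1 := mul_le_mul_of_nonneg_left (abs_le_runMax_self M (n + 1) ω) h0
      have h2 := mul_le_mul_of_nonneg_left (runMax_mono M ω n.le_succ) (hw0 n)
      dsimp only at h2
      linarith
  have h1 := key n
  have h2 : |w n ω * M n ω| ≤ w n ω * runMax M n ω := by
    rw [abs_mul, abs_of_nonneg (hw0 n)]
    exact mul_le_mul_of_nonneg_left (abs_le_runMax_self M n ω) (hw0 n)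
  have h3 := abs_add_le (paraproduct w M n ω - w n ω * M n ω) (w n ω * M n ω)
  rw [sub_add_cancel] at h3
  linarith

/-- Extrapolation towards smaller exponents. -/
lemma TransformBound.of_lt {p₁ r₁ : ℝ} (hT : p.HolderTriple q r) (hT₁ : p₁.HolderTriple q r₁)
    (hp : p < p₁) (hB : TransformBound.{u} p₁ q r₁) : TransformBound.{u} p q r := by
  obtain ⟨C, hC⟩ := hB
  refine ⟨2 * C, fun Ω m μ _ ℱ g a A h n => ?_⟩
  have hp0 := hT.pos
  have hp1 := hT₁.pos
  set θ := p / p₁ with hθ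
  have hθ0 : 0 < θ := div_pos hp0 hp1
  have hθ1 : 0 < 1 - θ := by rw [sub_pos, hθ, div_lt_one hp1]; exact hp
  have hp1' : p / θ = p₁ := by rw [hθ]; field_simp
  have hw : (p / (1 - θ)).HolderTriple r₁ r := by
    refine ⟨?_, div_pos hp0 hθ1, hT₁.pos'⟩
    rw [hT₁.inv_eq, hT.inv_eq, inv_div, hθ]
    field_simp
    ring
  have hgad := h.martingale.stronglyAdapted
  -- Factorization a = w b with w = A^(1-θ) increasing and |b| ≤ A^θ in L^{p₁}. Where A vanishes so
  -- does a, so the value of the negative power there is irrelevant.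
  set b : ℕ → Ω → ℝ := fun j ω => a j ω * A j ω ^ (-(1 - θ)) with hb
  set w : ℕ → Ω → ℝ := fun j ω => A j ω ^ (1 - θ) with hwdef
  have hbw : ∀ j ω, w j ω * b j ω = a j ω := fun j ω => by
    rcases (h.nonneg j ω).eq_or_lt with h0 | h0
    · have : a j ω = 0 := abs_nonpos_iff.1 (h0 ▸ h.abs_le j ω)
      simp [hb, this]
    · simp only [hb, hwdef, Real.rpow_neg h0.le]
      have : A j ω ^ (1 - θ) ≠ 0 := (Real.rpow_pos_of_pos h0 _).ne'
      field_simp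
  have hbA : ∀ j ω, |b j ω| ≤ A j ω ^ θ := fun j ω => by
    rcases (h.nonneg j ω).eq_or_lt with h0 | h0
    · have : a j ω = 0 := abs_nonpos_iff.1 (h0 ▸ h.abs_le j ω)
      simp only [hb, this, zero_mul, abs_zero]
      exact Real.rpow_nonneg (h.nonneg j ω) _
    · have h1 : 0 ≤ A j ω ^ (-(1 - θ)) := Real.rpow_nonneg h0.le _
      simp only [hb, abs_mul, abs_of_nonneg h1]
      calc _ ≤ A j ω * A j ω ^ (-(1 - θ)) := by gcongr; exact h.abs_le j ω
        _ = A j ω ^ (1 + -(1 - θ)) := by rw [Real.rpow_add h0, Real.rpow_one]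
        _ = _ := by congr 1; ring
  have hbad : StronglyAdapted ℱ b := fun j =>
    ((h.adapted_a j).measurable.mul
      ((h.adapted_A j).measurable.pow_const _)).stronglyMeasurable
  have d : TransformData μ ℱ p₁ q g b (fun j ω => A j ω ^ θ) :=
    { martingale := h.martingale
      inLp_g := h.inLp_g
      adapted_a := hbad
      adapted_A := fun j => ((h.adapted_A j).measurable.pow_const _).stronglyMeasurable
      mono := fun ω i j hij => Real.rpow_le_rpow (h.nonneg i ω) (h.mono ω hij) hθ0.le
      abs_le := hbA
      inLp_A := fun j => hp1' ▸ InLp.rpow hθ0 (h.nonneg j) (h.inLp_A j) }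
  have bd := hC Ω m μ inferInstance ℱ g b _ d n
  set M := paraproduct b g with hM
  have hN : ∀ i ω, paraproduct a g i ω = paraproduct w M i ω := fun i ω => by
    refine Finset.sum_congr rfl fun j _ => ?_
    rw [hM, paraproduct_succ, ← hbw j ω]
    ring
  have hmono : ∀ ω, Monotone fun j => w j ω := fun ω i j hij =>
    Real.rpow_le_rpow (h.nonneg i ω) (h.mono ω hij) hθ1.le
  have hw0 : ∀ j ω, 0 ≤ w j ω := fun j ω => Real.rpow_nonneg (h.nonneg j ω) _
  have path : ∀ ω, |runMax (paraproduct a g) n ω| ≤ ((2 : ℝ≥0) : ℝ) * (w n ω * runMax M n ω) := by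
    intro ω
    rw [abs_runMax]
    refine runMax_le fun i hi => ?_
    rw [hN]
    refine (abs_paraproduct_le_of_monotone (hmono ω) (fun j => hw0 j ω) (by simp [hM]) i).trans ?_
    have h1 := hmono ω hi
    have h2 := runMax_mono M ω hi
    have h3 := hw0 n ω
    have h4 := runMax_nonneg M i ω
    dsimp only at h1 h2
    change (2 : ℝ) * _ ≤ 2 * _
    gcongr
  have e₁ : lpn μ p₁ (fun ω => A n ω ^ θ) = lpn μ p (A n) ^ θ := by
    rw [← lpn_rpow hθ0 (h.nonneg n), hp1']
  have e₂ : lpn μ (p / (1 - θ)) (w n) = lpn μ p (A n) ^ (1 - θ) := lpn_rpow hθ1 (h.nonneg n)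
  calc lpn μ r (runMax (paraproduct a g) n)
      ≤ lpn μ r (fun ω => ((2 : ℝ≥0) : ℝ) * (w n ω * runMax M n ω)) := lpn_mono (ae_of_all _ path)
    _ = (2 : ℝ≥0) * lpn μ r (fun ω => w n ω * runMax M n ω) := lpn_const_mul _ _
    _ ≤ (2 : ℝ≥0) * (lpn μ p (A n) ^ (1 - θ) *
          (C * (lpn μ p (A n) ^ θ * lpn μ q (runMax g n)))) := by
      gcongr
      refine (lpn_mul_le hw ?_ ?_).trans ?_
      · exact (InLp.rpow hθ1 (h.nonneg n) (h.inLp_A n)).1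
      · exact runMax_paraproduct_aesm hbad hgad n
      · rw [e₂, ← e₁]; gcongr
    _ = (2 * C : ℝ≥0) * ((lpn μ p (A n) ^ (1 - θ) * lpn μ p (A n) ^ θ) *
          lpn μ q (runMax g n)) := by push_cast; ring
    _ = _ := by
      rw [← ENNReal.rpow_add_of_nonneg _ _ hθ1.le hθ0.le, sub_add_cancel, ENNReal.rpow_one]

/-- The transform bound for `q > 2`. -/
theorem transformBound_of_two_lt (hq : 2 < q) (hT : p.HolderTriple q r) :
    TransformBound.{u} p q r := by
  -- Induction on dyadic ranges of r with q fixed, p being determined by r: extrapolation from r = 2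
  -- covers r ≤ 2, and doubling does the rest.
  have key : ∀ k : ℕ, ∀ p r : ℝ, p.HolderTriple q r → r ≤ 2 * 2 ^ k → TransformBound.{u} p q r := by
    intro k
    induction k with
    | zero =>
      intro p r hT hr
      have hr0 := hT.pos'
      have hp0 := hT.pos
      rcases hr.eq_or_lt with h | h
      · have : r = 2 := by simpa using h
        subst this
        exact transformBound_two hT
      · have h2 : r < 2 := by simpa using h
        have hq0 : 0 < q := by linarith
        -- This is where q > 2 enters: the exponent paired with q at r = 2 must be finite and
        -- positive.
        have hlt : 0 < (2 : ℝ)⁻¹ - q⁻¹ := by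
          rw [sub_pos]; exact inv_strictAnti₀ two_pos hq
        have hT₁ : ((2 : ℝ)⁻¹ - q⁻¹)⁻¹.HolderTriple q 2 :=
          ⟨by rw [inv_inv]; ring, inv_pos.2 hlt, hq0⟩
        refine TransformBound.of_lt hT hT₁ ?_ (transformBound_two hT₁)
        rw [lt_inv_comm₀ hp0 hlt, ← hT.inv_sub_inv_eq_inv]
        have := inv_strictAnti₀ hr0 h2
        linarith
    | succ k ih =>
      intro p r hT hr
      have hr0 := hT.pos'
      have hp0 := hT.pos
      have e : (r / 2)⁻¹ - q⁻¹ = r⁻¹ + p⁻¹ := by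
        rw [← hT.inv_sub_inv_eq_inv]; field_simp; ring
      have hpos : 0 < r⁻¹ + p⁻¹ := by positivity
      have hT' : (r⁻¹ + p⁻¹)⁻¹.HolderTriple q (r / 2) :=
        ⟨by rw [inv_inv, ← e]; ring, inv_pos.2 hpos, hT.symm.pos⟩
      refine TransformBound.double hT hT' (ih _ _ hT' ?_)
      rw [pow_succ] at hr
      linarith
  obtain ⟨k, hk⟩ := pow_unbounded_of_one_lt r one_lt_two
  refine key k p r hT (hk.le.trans ?_)
  have : (0 : ℝ) < 2 ^ k := by positivity
  linarith

end TransformBound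

end

noncomputable section

/-! ### Transforms of martingales in `L^q`, `q > 1` -/

section TransformBoundGeneral

variable {Ω : Type*} {m : MeasurableSpace Ω} {μ : Measure Ω} {ℱ : Filtration ℕ m} {p q r : ℝ}
  {g a A : ℕ → Ω → ℝ}

lemma inLp_sqrt {X : Ω → ℝ} (h : InLp μ q X) :
    InLp μ (2 * q) (fun ω => √(X ω)) := by
  have h1 : InLp μ q (fun ω => |X ω|) := h.norm
  have h2 := InLp.rpow (s := 1 / 2) (by norm_num) (fun ω => abs_nonneg (X ω)) h1
  rw [show q / (1 / 2) = 2 * q by ring] at h2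
  refine h2.mono (Real.continuous_sqrt.comp_aestronglyMeasurable h.1) (ae_of_all _ fun ω => ?_)
  rw [← Real.sqrt_eq_rpow, abs_of_nonneg (Real.sqrt_nonneg _)]
  exact Real.sqrt_le_sqrt (le_abs_self _)

/-- The square root of a nonnegative martingale is a supermartingale. -/
lemma supermartingale_sqrt [IsFiniteMeasure μ] (hq : 1 < q) (hg : Martingale g ℱ μ)
    (hgq : ∀ n, InLp μ q (g n)) (hg0 : ∀ n, ∀ᵐ ω ∂μ, 0 ≤ g n ω) :
    Supermartingale (fun n ω => √(g n ω)) ℱ μ := by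
  have hu : ∀ n, InLp μ (2 * q) (fun ω => √(g n ω)) := fun n => inLp_sqrt (hgq n)
  have hu2 : ∀ n, MemLp (fun ω => √(g n ω)) 2 μ := fun n => (hu n).mono_exponent (by
    rw [show (2 : ℝ≥0∞) = ENNReal.ofReal 2 by simp]
    exact ENNReal.ofReal_le_ofReal (by linarith))
  have hi : ∀ n, Integrable (fun ω => √(g n ω)) μ := fun n => (hu2 n).integrable (by norm_num)
  refine supermartingale_nat
    (fun n => Real.continuous_sqrt.comp_stronglyMeasurable (hg.stronglyAdapted n)) hi fun n => ?_
  -- Conditional Jensen for the square root, read off from nonnegativity of the conditional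
  -- variance.
  have h1 := ProbabilityTheory.condVar_ae_eq_condExp_sq_sub_sq_condExp (ℱ.le n) (hu2 (n + 1))
  have h2 : 0 ≤ᵐ[μ] ProbabilityTheory.condVar (ℱ n) (fun ω => √(g (n + 1) ω)) μ :=
    condExp_nonneg (ae_of_all _ fun ω => sq_nonneg _)
  have h3 : μ[(fun ω => √(g (n + 1) ω)) ^ 2 | ℱ n] =ᵐ[μ] μ[g (n + 1) | ℱ n] := by
    refine condExp_congr_ae ?_
    filter_upwards [hg0 (n + 1)] with ω hω
    exact Real.sq_sqrt hω
  filter_upwards [h1, h2, h3, hg.condExp_ae_eq n.le_succ] with ω a b c d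
  rw [a] at b
  simp only [Pi.zero_apply, Pi.sub_apply, Pi.pow_apply, c, d, sub_nonneg] at b
  exact (le_abs_self _).trans (Real.abs_le_sqrt b)

lemma abs_paraproduct_le_of_increasing {b B : ℕ → Ω → ℝ} {ω : Ω} {c : ℝ} {n : ℕ}
    (hB : Monotone fun n => B n ω) (hB0 : B 0 ω = 0) (hb : ∀ j ≤ n, |b j ω| ≤ c) :
    |paraproduct b B n ω| ≤ c * B n ω := by
  have : c * B n ω = ∑ j ∈ Finset.range n, c * (B (j + 1) ω - B j ω) := by
    rw [← Finset.mul_sum, Finset.sum_range_sub (fun j => B j ω), hB0, sub_zero]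
  rw [this]
  refine (Finset.abs_sum_le_sum_abs _ _).trans (Finset.sum_le_sum fun j hj => ?_)
  have h0 : 0 ≤ B (j + 1) ω - B j ω := sub_nonneg.2 (hB j.le_succ)
  rw [abs_mul, abs_of_nonneg h0]
  exact mul_le_mul_of_nonneg_right (hb j (Finset.mem_range.1 hj).le) h0

/-- Transform of `u²`, where `u + B` replaces `u` in the paraproducts. -/
lemma abs_paraproduct_sq_le {u B : ℕ → Ω → ℝ} {ω : Ω} (hA : Monotone fun n => A n ω)
    (haA : ∀ n, |a n ω| ≤ A n ω) (hu : ∀ n, 0 ≤ u n ω)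
    (hB : Monotone fun n => B n ω) (hB0 : B 0 ω = 0) (hg : ∀ n, g n ω = u n ω ^ 2) (n : ℕ) :
    |paraproduct a g n ω| ≤ 6 * (A n ω * (runMax u n ω + |B n ω|) ^ 2)
      + 4 * |paraproduct (fun j ω => A j ω * (u j ω + B j ω)) (fun j ω => u j ω + B j ω) n ω|
      + 2 * |paraproduct (fun j ω => a j ω * u j ω) (fun j ω => u j ω + B j ω) n ω| := by
  have hBn : ∀ n, 0 ≤ B n ω := fun n => hB0 ▸ hB (Nat.zero_le n)
  have hA0 : ∀ n, 0 ≤ A n ω := fun n => (abs_nonneg _).trans (haA n)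
  set M : ℕ → Ω → ℝ := fun j ω => u j ω + B j ω with hM
  -- The increment of u² is (Δu)² + 2uΔu; in the second term Δu = ΔM - ΔB.
  have e : paraproduct a g n ω = weightedSq a u n ω
      + 2 * (paraproduct (fun j ω => a j ω * u j ω) M n ω
        - paraproduct (fun j ω => a j ω * u j ω) B n ω) := by
    simp only [paraproduct, weightedSq, hM]
    rw [← Finset.sum_sub_distrib, Finset.mul_sum, ← Finset.sum_add_distrib]
    refine Finset.sum_congr rfl fun j _ => ?_
    rw [hg, hg]; ring
  have h1 : |weightedSq a u n ω| ≤ 2 * weightedSq A M n ω + 2 * weightedSq A B n ω := by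
    simp only [weightedSq, Finset.mul_sum]
    rw [← Finset.sum_add_distrib]
    refine (Finset.abs_sum_le_sum_abs _ _).trans (Finset.sum_le_sum fun j _ => ?_)
    rw [abs_mul, abs_of_nonneg (sq_nonneg (u (j + 1) ω - u j ω))]
    have h := mul_le_mul_of_nonneg_right (haA j) (sq_nonneg (u (j + 1) ω - u j ω))
    have h' : (u (j + 1) ω - u j ω) ^ 2
        ≤ 2 * (M (j + 1) ω - M j ω) ^ 2 + 2 * (B (j + 1) ω - B j ω) ^ 2 := by
      simp only [hM]
      nlinarith [sq_nonneg ((u (j + 1) ω + B (j + 1) ω - (u j ω + B j ω))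
        + (B (j + 1) ω - B j ω))]
    have h'' := mul_le_mul_of_nonneg_left h' (hA0 j)
    linarith
  have h2 := weightedSq_le M hA (hA0 0) n
  have h3 := weightedSq_le B hA (hA0 0) n
  -- This transform enters the bound for the squared increments of B with a negative sign, so it can
  -- be discarded. The constant 6 is 2 each from A M², A B² and the transform against B.
  have h4 : 0 ≤ paraproduct (fun j ω => A j ω * B j ω) B n ω :=
    Finset.sum_nonneg fun j _ =>
      mul_nonneg (mul_nonneg (hA0 j) (hBn j)) (sub_nonneg.2 (hB j.le_succ))
  have hu1 : u n ω ≤ runMax u n ω := (le_abs_self _).trans (abs_le_runMax_self u n ω)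
  have hu2 := runMax_nonneg u n ω
  have h5 : |paraproduct (fun j ω => a j ω * u j ω) B n ω| ≤ A n ω * runMax u n ω * B n ω := by
    refine abs_paraproduct_le_of_increasing hB hB0 fun j hj => ?_
    rw [abs_mul]
    exact mul_le_mul ((haA j).trans (hA hj)) (abs_le_runMax u hj ω) (abs_nonneg _) (hA0 n)
  rw [abs_of_nonneg (hBn n)]
  have hB' := hBn n
  have hA' := hA0 n
  have h6 : A n ω * M n ω ^ 2 ≤ A n ω * (runMax u n ω + B n ω) ^ 2 := by
    have := hu n
    simp only [hM]
    gcongr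
  have h7 : A n ω * B n ω ^ 2 ≤ A n ω * (runMax u n ω + B n ω) ^ 2 := by
    gcongr; linarith
  have h8 : A n ω * runMax u n ω * B n ω ≤ A n ω * (runMax u n ω + B n ω) ^ 2 := by
    rw [mul_assoc]
    gcongr
    nlinarith [mul_nonneg hu2 hB', sq_nonneg (runMax u n ω), sq_nonneg (B n ω)]
  rw [e]
  have t1 := abs_add_le (weightedSq a u n ω) (2 * (paraproduct (fun j ω => a j ω * u j ω) M n ω
        - paraproduct (fun j ω => a j ω * u j ω) B n ω))
  have t2 := abs_sub (paraproduct (fun j ω => a j ω * u j ω) M n ω)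
    (paraproduct (fun j ω => a j ω * u j ω) B n ω)
  rw [abs_mul, abs_two] at t1
  have t3 := neg_abs_le (paraproduct (fun j ω => A j ω * M j ω) M n ω)
  linarith

/-- The transform bound for nonnegative martingales. -/
lemma transformBound_nonneg (hq : 1 < q) (hT : p.HolderTriple q r) :
    ∃ C : ℝ≥0, ∀ (Ω : Type u) (m : MeasurableSpace Ω) (μ : Measure Ω) (_ : IsProbabilityMeasure μ)
      (ℱ : Filtration ℕ m) (g a A : ℕ → Ω → ℝ), TransformData μ ℱ p q g a A →
      (∀ n, ∀ᵐ ω ∂μ, 0 ≤ g n ω) →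
      ∀ n, lpn μ r (runMax (paraproduct a g) n) ≤ C * (lpn μ p (A n) * lpn μ q (runMax g n)) := by
  have hq0 : 0 < q := by linarith
  have hp0 := hT.pos
  set p₁ := (p⁻¹ + (2 * q)⁻¹)⁻¹ with hp₁
  -- Coefficients of the form A·M or a·u lie in L^{p₁}, and p₁ with 2q leads back to r.
  have hT₁ : p.HolderTriple (2 * q) p₁ := Real.HolderTriple.of_pos hp0 (by positivity)
  have hT₂ : p₁.HolderTriple (2 * q) r :=
    ⟨by rw [← hT₁.inv_add_inv_eq_inv, ← hT.inv_add_inv_eq_inv, mul_inv]; ring, hT₁.pos',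
      by positivity⟩
  obtain ⟨C, hC⟩ := transformBound_of_two_lt.{u} (by linarith : 2 < 2 * q) hT₂
  set K := addConst r with hK
  set D : ℝ≥0 := addConst (2 * q) * (1 + (2 * q).toNNReal) with hD
  refine ⟨K * (6 + K * (4 * C + 2 * C)) * D ^ 2, fun Ω m μ _ ℱ g a A h hg0 n => ?_⟩
  set u : ℕ → Ω → ℝ := fun n ω => √(g n ω) with hu
  have hus : Supermartingale u ℱ μ := supermartingale_sqrt hq h.martingale h.inLp_g hg0
  have huL : ∀ n, InLp μ (2 * q) (u n) := fun n => inLp_sqrt (h.inLp_g n)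
  have hu0 : ∀ n ω, 0 ≤ u n ω := fun n ω => Real.sqrt_nonneg _
  set B := compensator u ℱ μ with hB
  have h2q : 1 < 2 * q := by linarith
  have hBL : ∀ n, InLp μ (2 * q) (B n) := InLp.compensator h2q huL
  have hBabs : InLp μ (2 * q) (fun ω => |B n ω|) := (hBL n).norm
  have hBn := lpn_compensator_le h2q hus hu0 huL n
  set M : ℕ → Ω → ℝ := fun j ω => u j ω + B j ω with hM
  have hMm : Martingale M ℱ μ := by
    have := martingale_martingalePart (f := u) (ℱ := ℱ) (μ := μ) hus.stronglyAdapted hus.integrable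
    have e : martingalePart u ℱ μ = M := by
      ext j ω; exact martingalePart_eq_add_compensator u ℱ μ j ω
    rwa [e] at this
  have hML : ∀ n, InLp μ (2 * q) (M n) := fun n => (huL n).add (hBL n)
  have hMad := hMm.stronglyAdapted
  set V : Ω → ℝ := fun ω => runMax u n ω + |B n ω| with hV
  have hRu := InLp.runMax huL
  have hRM := InLp.runMax hML
  have hVL : InLp μ (2 * q) V := (hRu n).add hBabs
  set v := lpn μ (2 * q) V with hv
  set G := lpn μ q (runMax g n) with hG
  have hgu : ∀ᵐ ω ∂μ, ∀ n, g n ω = u n ω ^ 2 := by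
    filter_upwards [ae_all_iff.2 hg0] with ω hω n
    exact (Real.sq_sqrt (hω n)).symm
  have hBmono := compensator_monotone hus
  have huG : lpn μ (2 * q) (runMax u n) ^ 2 ≤ G := by
    rw [← lpn_sq, mul_div_cancel_left₀ q two_ne_zero]
    refine lpn_mono ?_
    filter_upwards [hgu] with ω hω
    rw [abs_of_nonneg (sq_nonneg _)]
    refine (Real.le_sqrt (runMax_nonneg u n ω) (runMax_nonneg g n ω)).1 (runMax_le fun i hi => ?_)
    refine Real.le_sqrt_of_sq_le ?_
    rw [sq_abs, ← hω i]
    exact (le_abs_self _).trans (abs_le_runMax g hi ω)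
  have hvD : v ≤ D * lpn μ (2 * q) (runMax u n) := by
    refine (lpn_add_le (2 * q) (hRu n).1 hBabs.1).trans ?_
    rw [lpn_abs, hD]
    push_cast
    rw [mul_assoc, add_mul, one_mul]
    gcongr
    exact hBn
  have hvG : v ^ 2 ≤ D ^ 2 * G := by
    calc v ^ 2 ≤ (D * lpn μ (2 * q) (runMax u n)) ^ 2 := by gcongr
      _ = D ^ 2 * lpn μ (2 * q) (runMax u n) ^ 2 := by ring
      _ ≤ _ := by gcongr
  have huv : lpn μ (2 * q) (runMax u n) ≤ v := lpn_mono (ae_of_all _ fun ω => by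
    rw [abs_runMax]
    exact le_add_of_nonneg_right (abs_nonneg _))
  -- M = u + B is dominated pathwise by max u + B_n, since B increases.
  have hMv : lpn μ (2 * q) (runMax M n) ≤ v := lpn_mono (by
    filter_upwards [hBmono] with ω hω
    rw [abs_runMax]
    have hb : ∀ i, 0 ≤ B i ω := fun i =>
      (compensator_zero u ℱ μ ω).symm.le.trans (hω (Nat.zero_le i))
    refine runMax_le fun i hi => ?_
    rw [abs_of_nonneg (add_nonneg (hu0 i ω) (hb i))]
    refine add_le_add ((le_abs_self _).trans (abs_le_runMax u hi ω)) ?_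
    exact (hω hi).trans (le_abs_self _))
  set a₁ : ℕ → Ω → ℝ := fun j ω => A j ω * M j ω with ha₁
  set a₂ : ℕ → Ω → ℝ := fun j ω => a j ω * u j ω with ha₂
  have had₁ : StronglyAdapted ℱ a₁ := fun j => (h.adapted_A j).mul (hMad j)
  have had₂ : StronglyAdapted ℱ a₂ := fun j => (h.adapted_a j).mul (hus.stronglyAdapted j)
  have monoMul : ∀ (X : ℕ → Ω → ℝ) ω, Monotone fun j => A j ω * runMax X j ω :=
    fun X ω i j hij => mul_le_mul (h.mono ω hij) (runMax_mono X ω hij) (runMax_nonneg X i ω)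
      (h.nonneg j ω)
  have d₁ : TransformData μ ℱ p₁ (2 * q) M a₁ (fun j ω => A j ω * runMax M j ω) :=
    { martingale := hMm
      inLp_g := hML
      adapted_a := had₁
      adapted_A := fun j => (h.adapted_A j).mul (runMax_stronglyAdapted hMad j)
      mono := monoMul M
      abs_le := fun j ω => by
        rw [ha₁, abs_mul, abs_of_nonneg (h.nonneg j ω)]
        exact mul_le_mul_of_nonneg_left (abs_le_runMax_self M j ω) (h.nonneg j ω)
      inLp_A := fun j => InLp.mul hT₁ (h.inLp_A j) (hRM j) }
  have d₂ : TransformData μ ℱ p₁ (2 * q) M a₂ (fun j ω => A j ω * runMax u j ω) :=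
    { martingale := hMm
      inLp_g := hML
      adapted_a := had₂
      adapted_A := fun j => (h.adapted_A j).mul (runMax_stronglyAdapted hus.stronglyAdapted j)
      mono := monoMul u
      abs_le := fun j ω => by
        rw [ha₂, abs_mul]
        exact mul_le_mul (h.abs_le j ω) (abs_le_runMax_self u j ω) (abs_nonneg _) (h.nonneg j ω)
      inLp_A := fun j => InLp.mul hT₁ (h.inLp_A j) (hRu j) }
  have b₁ : lpn μ r (runMax (paraproduct a₁ M) n) ≤ C * (lpn μ p (A n) * v ^ 2) := by
    refine (hC Ω m μ inferInstance ℱ M a₁ _ d₁ n).trans (mul_le_mul_right ?_ _)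
    rw [sq, ← mul_assoc]
    exact mul_le_mul' ((lpn_mul_le hT₁ (h.aesm_A n) (hRM n).1).trans (mul_le_mul_right hMv _)) hMv
  have b₂ : lpn μ r (runMax (paraproduct a₂ M) n) ≤ C * (lpn μ p (A n) * v ^ 2) := by
    refine (hC Ω m μ inferInstance ℱ M a₂ _ d₂ n).trans (mul_le_mul_right ?_ _)
    rw [sq, ← mul_assoc]
    exact mul_le_mul' ((lpn_mul_le hT₁ (h.aesm_A n) (hRu n).1).trans (mul_le_mul_right huv _)) hMv
  have b₀ : lpn μ r (fun ω => A n ω * V ω ^ 2) ≤ lpn μ p (A n) * v ^ 2 := by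
    refine (lpn_mul_le hT (h.aesm_A n) (hVL.1.pow 2)).trans ?_
    have := lpn_sq (μ := μ) (r := 2 * q) V
    rw [mul_div_cancel_left₀ q two_ne_zero] at this
    exact mul_le_mul_right this.le _
  have s₁ := runMax_paraproduct_aesm (μ := μ) had₁ hMad n
  have s₂ := runMax_paraproduct_aesm (μ := μ) had₂ hMad n
  have s₀ : AEStronglyMeasurable (fun ω => A n ω * V ω ^ 2) μ := (h.aesm_A n).mul (hVL.1.pow 2)
  have path : ∀ᵐ ω ∂μ, |runMax (paraproduct a g) n ω| ≤ ((6 : ℝ≥0) : ℝ) * (A n ω * V ω ^ 2)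
      + (((4 : ℝ≥0) : ℝ) * runMax (paraproduct a₁ M) n ω
        + ((2 : ℝ≥0) : ℝ) * runMax (paraproduct a₂ M) n ω) := by
    filter_upwards [hgu, hBmono] with ω h1 h2
    rw [abs_runMax]
    refine runMax_le fun i hi => ?_
    have h3 := abs_paraproduct_sq_le (h.mono ω) (fun n => h.abs_le n ω) (fun n => hu0 n ω) h2
      (compensator_zero u ℱ μ ω) h1 i
    have h4 := abs_le_runMax (paraproduct a₁ M) hi ω
    have h5 := abs_le_runMax (paraproduct a₂ M) hi ω
    have hb : ∀ i, 0 ≤ B i ω := fun i =>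
      (compensator_zero u ℱ μ ω).symm.le.trans (h2 (Nat.zero_le i))
    have h6 : A i ω * (runMax u i ω + |B i ω|) ^ 2 ≤ A n ω * V ω ^ 2 := by
      have t1 := h.mono ω hi
      have t2 := runMax_mono u ω hi
      have t3 := h2 hi
      have t4 := runMax_nonneg u i ω
      have t5 := h.nonneg n ω
      dsimp only at t1 t2 t3
      have t6 : |B i ω| ≤ |B n ω| := by
        rw [abs_of_nonneg (hb i), abs_of_nonneg (hb n)]; exact t3
      simp only [hV]
      gcongr
    change _ ≤ 6 * _ + (4 * _ + 2 * _)
    change |paraproduct a g i ω| ≤ 6 * (A i ω * (runMax u i ω + |B i ω|) ^ 2)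
      + 4 * |paraproduct a₁ M i ω| + 2 * |paraproduct a₂ M i ω| at h3
    linarith
  calc lpn μ r (runMax (paraproduct a g) n)
      ≤ K * (lpn μ r (fun ω => ((6 : ℝ≥0) : ℝ) * (A n ω * V ω ^ 2))
        + lpn μ r (fun ω => ((4 : ℝ≥0) : ℝ) * runMax (paraproduct a₁ M) n ω
        + ((2 : ℝ≥0) : ℝ) * runMax (paraproduct a₂ M) n ω)) :=
      (lpn_mono path).trans (lpn_add_le r (s₀.const_mul _) ((s₁.const_mul _).add (s₂.const_mul _)))
    _ ≤ K * ((6 : ℝ≥0) * (lpn μ p (A n) * v ^ 2)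
        + K * ((4 : ℝ≥0) * (C * (lpn μ p (A n) * v ^ 2))
          + (2 : ℝ≥0) * (C * (lpn μ p (A n) * v ^ 2)))) := by
      refine mul_le_mul_right (add_le_add ?_ ((lpn_add_le r (s₁.const_mul _)
        (s₂.const_mul _)).trans (mul_le_mul_right (add_le_add ?_ ?_) _))) _
      · rw [lpn_const_mul]; gcongr
      · rw [lpn_const_mul]; gcongr
      · rw [lpn_const_mul]; gcongr
    _ = K * (6 + K * (4 * C + 2 * C)) * (lpn μ p (A n) * v ^ 2) := by push_cast; ring
    _ ≤ K * (6 + K * (4 * C + 2 * C)) * (lpn μ p (A n) * (D ^ 2 * G)) := by gcongr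
    _ = _ := by push_cast; ring

/-- The transform bound for all `q > 1`. -/
theorem transformBound (hq : 1 < q) (hT : p.HolderTriple q r) : TransformBound.{u} p q r := by
  obtain ⟨C, hC⟩ := transformBound_nonneg.{u} hq hT
  set E : ℝ≥0 := (q / (q - 1)).toNNReal with hE
  refine ⟨addConst r * (C * E + C * E), fun Ω m μ _ ℱ g a A h n => ?_⟩
  have h1q : (1 : ℝ≥0∞) ≤ ENNReal.ofReal q := by simpa using hq.le
  set G := lpn μ q (runMax g n) with hG
  have part : ∀ X : Ω → ℝ, AEStronglyMeasurable X μ → (∀ ω, 0 ≤ X ω) → (∀ ω, X ω ≤ |g n ω|) →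
      TransformData μ ℱ p q (fun j => μ[X | ℱ j]) a A ∧
      lpn μ r (runMax (paraproduct a (fun j => μ[X | ℱ j])) n) ≤ C * E * (lpn μ p (A n) * G) := by
    intro X hXm hX0 hXg
    have hgn : InLp μ q (fun ω => |g n ω|) := (h.inLp_g n).norm
    have hXL : InLp μ q X := hgn.mono hXm (ae_of_all _ fun ω => by
      rw [abs_of_nonneg (hX0 ω)]; exact hXg ω)
    have hm : Martingale (fun j => μ[X | ℱ j]) ℱ μ := martingale_condExp X ℱ μ
    have hL : ∀ j, InLp μ q (μ[X | ℱ j]) := fun j => MemLp.condExp h1q hXL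
    have d : TransformData μ ℱ p q (fun j => μ[X | ℱ j]) a A :=
      { martingale := hm
        inLp_g := hL
        adapted_a := h.adapted_a
        adapted_A := h.adapted_A
        mono := h.mono
        abs_le := h.abs_le
        inLp_A := h.inLp_A }
    refine ⟨d, (hC Ω m μ inferInstance ℱ _ a A d
      (fun j => condExp_nonneg (ae_of_all _ hX0)) n).trans ?_⟩
    have h1 := lpn_runMax_le hq hm hL n
    have h2 : lpn μ q (μ[X | ℱ n]) ≤ lpn μ q X := eLpNorm_condExp_le_eLpNorm X h1q
    have h3 : lpn μ q X ≤ G := lpn_mono (ae_of_all _ fun ω => by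
      rw [abs_of_nonneg (hX0 ω)]; exact (hXg ω).trans (abs_le_runMax_self g n ω))
    calc _ ≤ (C : ℝ≥0∞) * (lpn μ p (A n) * (E * G)) := by
          refine mul_le_mul_right (mul_le_mul_right ?_ _) _
          exact h1.trans (mul_le_mul' le_rfl (h2.trans h3))
      _ = _ := by ring
  have hgm : AEStronglyMeasurable (g n) μ := (h.inLp_g n).1
  have hgc : AEStronglyMeasurable (fun ω => max (g n ω) 0) μ :=
    hgm.sup aestronglyMeasurable_const
  have hgc' : AEStronglyMeasurable (fun ω => max (-g n ω) 0) μ :=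
    hgm.neg.sup aestronglyMeasurable_const
  obtain ⟨d₁, b₁⟩ := part (fun ω => max (g n ω) 0) hgc (fun ω => le_max_right _ _)
    (fun ω => max_le (le_abs_self _) (abs_nonneg _))
  obtain ⟨d₂, b₂⟩ := part (fun ω => max (-g n ω) 0) hgc' (fun ω => le_max_right _ _)
    (fun ω => max_le (neg_le_abs _) (abs_nonneg _))
  set h₁ : ℕ → Ω → ℝ := fun j => μ[fun ω => max (g n ω) 0 | ℱ j]
  set h₂ : ℕ → Ω → ℝ := fun j => μ[fun ω => max (-g n ω) 0 | ℱ j]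
  have hint : Integrable (g n) μ := h.martingale.integrable n
  have hi₁ : Integrable (fun ω => max (g n ω) 0) μ := hint.pos_part
  have hi₂ : Integrable (fun ω => max (-g n ω) 0) μ := hint.neg_part
  -- The two nonnegative martingales are built from the fixed terminal value g n, so they recover g
  -- only up to time n; the transforms up to time n see nothing later.
  have split : ∀ᵐ ω ∂μ, ∀ j, j ≤ n → g j ω = h₁ j ω - h₂ j ω := by
    rw [ae_all_iff]
    intro j
    by_cases hj : j ≤ n
    · have e : (fun ω => max (g n ω) 0) - (fun ω => max (-g n ω) 0) = g n := by
        ext ω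
        simp only [Pi.sub_apply]
        rcases le_total 0 (g n ω) with h0 | h0
        · rw [max_eq_left h0, max_eq_right (by linarith)]; ring
        · rw [max_eq_right h0, max_eq_left (by linarith)]; ring
      have hs := condExp_sub hi₁ hi₂ (ℱ j)
      rw [e] at hs
      filter_upwards [hs, h.martingale.condExp_ae_eq hj] with ω x y _
      rw [← y, x]; rfl
    · exact ae_of_all _ fun ω hj' => absurd hj' hj
  have path : ∀ᵐ ω ∂μ, |runMax (paraproduct a g) n ω|
      ≤ runMax (paraproduct a h₁) n ω + runMax (paraproduct a h₂) n ω := by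
    filter_upwards [split] with ω hω
    rw [abs_runMax]
    refine runMax_le fun i hi => ?_
    have e : paraproduct a g i ω = paraproduct a h₁ i ω - paraproduct a h₂ i ω := by
      simp only [paraproduct]
      rw [← Finset.sum_sub_distrib]
      refine Finset.sum_congr rfl fun j hj => ?_
      have hj' := Finset.mem_range.1 hj
      rw [hω j (by omega), hω (j + 1) (by omega)]
      ring
    rw [e]
    exact (abs_sub _ _).trans (add_le_add (abs_le_runMax _ hi ω) (abs_le_runMax _ hi ω))
  have s₁ := runMax_paraproduct_aesm (μ := μ) h.adapted_a d₁.martingale.stronglyAdapted n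
  have s₂ := runMax_paraproduct_aesm (μ := μ) h.adapted_a d₂.martingale.stronglyAdapted n
  calc lpn μ r (runMax (paraproduct a g) n)
      ≤ addConst r * (lpn μ r (runMax (paraproduct a h₁) n)
        + lpn μ r (runMax (paraproduct a h₂) n)) := (lpn_mono path).trans (lpn_add_le r s₁ s₂)
    _ ≤ addConst r * (C * E * (lpn μ p (A n) * G) + C * E * (lpn μ p (A n) * G)) := by gcongr
    _ = _ := by push_cast; ring

end TransformBoundGeneral

end

noncomputable section

/-! ### Pathwise inequalities of Davis and Doob type -/

section Pathwise

variable {Ω : Type*}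

/-- One step of the Davis inequality, with c² the squared increments so far, x the current value and
d the next increment. For |d| ≤ 2R the second-order error d²/R is at most 6(c' - c), because d² =
(c' - c)(c' + c) and c' + c ≤ 4R. For |d| > 2R the left side is at most 2|d|, while c' - c ≥ |d|/2
and the linear term is at least -|d|; the 6 is chosen to make 3|d| - |d| = 2|d|. -/
lemma davis_step (x d : ℝ) {c : ℝ} (hc : 0 ≤ c) :
    √(c ^ 2 + d ^ 2 + (x + d) ^ 2) ≤ √(c ^ 2 + x ^ 2) + x / √(c ^ 2 + x ^ 2) * d
      + 6 * (√(c ^ 2 + d ^ 2) - c) := by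
  set R := √(c ^ 2 + x ^ 2) with hR
  set c' := √(c ^ 2 + d ^ 2) with hc'
  have hR0 : 0 ≤ R := Real.sqrt_nonneg _
  have hR2 : R ^ 2 = c ^ 2 + x ^ 2 := Real.sq_sqrt (by positivity)
  have hc'2 : c' ^ 2 = c ^ 2 + d ^ 2 := Real.sq_sqrt (by positivity)
  have hc'0 : 0 ≤ c' := Real.sqrt_nonneg _
  have hcR : c ≤ R := Real.le_sqrt_of_sq_le (by nlinarith)
  have hxR : |x| ≤ R := Real.abs_le_sqrt (by nlinarith)
  have hcc' : c ≤ c' := Real.le_sqrt_of_sq_le (by nlinarith)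
  have hc'd : c' ≤ c + |d| := by
    rw [hc']; refine Real.sqrt_le_iff.2 ⟨by positivity, ?_⟩
    nlinarith [mul_nonneg hc (abs_nonneg d), sq_abs d]
  have hdiff : (c' - c) * (c' + c) = d ^ 2 := by nlinarith
  rcases le_or_gt |d| (2 * R) with h | h
  · rcases hR0.eq_or_lt with h0 | h0
    · have hd : d = 0 := by
        rw [← h0, mul_zero] at h
        exact abs_nonpos_iff.1 h
      have : c ^ 2 + d ^ 2 + (x + d) ^ 2 = c ^ 2 + x ^ 2 := by rw [hd]; ring
      rw [this, ← hR, hd]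
      nlinarith
    · have h1 : d ^ 2 / R ≤ 6 * (c' - c) := by
        rw [div_le_iff₀ h0, ← hdiff]
        have : 0 ≤ c' - c := by linarith
        nlinarith
      have h2 : √(c ^ 2 + d ^ 2 + (x + d) ^ 2) ≤ R + x / R * d + d ^ 2 / R := by
        have e : R + x / R * d + d ^ 2 / R = (R ^ 2 + x * d + d ^ 2) / R := by
          field_simp
        have hnum : 0 ≤ R ^ 2 + x * d + d ^ 2 := by
          rw [hR2]; nlinarith [sq_nonneg (x + d), sq_nonneg x, sq_nonneg d]
        refine Real.sqrt_le_iff.2 ⟨by rw [e]; positivity, ?_⟩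
        rw [e, div_pow, le_div_iff₀ (by positivity)]
        have : c ^ 2 + d ^ 2 + (x + d) ^ 2 = R ^ 2 + 2 * (x * d + d ^ 2) := by rw [hR2]; ring
        rw [this]
        nlinarith [sq_nonneg (x * d + d ^ 2)]
      linarith
  · have hd0 : 0 < |d| := by linarith
    have h1 : √(c ^ 2 + d ^ 2 + (x + d) ^ 2) ≤ 2 * |d| := by
      refine Real.sqrt_le_iff.2 ⟨by positivity, ?_⟩
      have t1 : x * d ≤ |x| * |d| := by rw [← abs_mul]; exact le_abs_self _
      have t2 : |x| * |d| ≤ |d| * |d| / 2 := by nlinarith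
      have t3 : R ^ 2 ≤ |d| ^ 2 / 4 := by nlinarith
      nlinarith [sq_abs d]
    have h2 : |d| / 2 ≤ c' - c := by
      have : |d| ^ 2 ≤ (c' - c) * (2 * |d|) := by
        rw [sq_abs, ← hdiff]
        have : 0 ≤ c' - c := by linarith
        nlinarith
      nlinarith
    have h3 : -|d| ≤ x / R * d := by
      have : |x / R * d| ≤ |d| := by
        rw [abs_mul, abs_div, abs_of_nonneg hR0]
        exact mul_le_of_le_one_left (abs_nonneg _) (div_le_one_of_le₀ hxR hR0)
      exact neg_le_of_abs_le this
    linarith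

/-- The sum of squared increments. -/
def sqSum (h : ℕ → Ω → ℝ) (n : ℕ) (ω : Ω) : ℝ :=
  ∑ j ∈ Finset.range n, (h (j + 1) ω - h j ω) ^ 2

lemma sqSum_succ (h : ℕ → Ω → ℝ) (n : ℕ) (ω : Ω) :
    sqSum h (n + 1) ω = sqSum h n ω + (h (n + 1) ω - h n ω) ^ 2 := by
  simp [sqSum, Finset.sum_range_succ]

lemma sqSum_nonneg (h : ℕ → Ω → ℝ) (n : ℕ) (ω : Ω) : 0 ≤ sqSum h n ω :=
  Finset.sum_nonneg fun _ _ => sq_nonneg _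

lemma sq_eq_sqSum_add (h : ℕ → Ω → ℝ) (n : ℕ) (ω : Ω) :
    h n ω ^ 2 = h 0 ω ^ 2 + sqSum h n ω + 2 * paraproduct h h n ω := by
  induction n with
  | zero => simp [sqSum]
  | succ n ih =>
    rw [sqSum_succ, paraproduct_succ]
    nlinarith

/-- The bounded coefficients in the pathwise Davis inequality. -/
def davisCoeff (h : ℕ → Ω → ℝ) (n : ℕ) (ω : Ω) : ℝ :=
  h n ω / √(sqSum h n ω + h n ω ^ 2)

lemma abs_davisCoeff_le (h : ℕ → Ω → ℝ) (n : ℕ) (ω : Ω) : |davisCoeff h n ω| ≤ 1 := by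
  rw [davisCoeff, abs_div, abs_of_nonneg (Real.sqrt_nonneg _)]
  refine div_le_one_of_le₀ (Real.abs_le_sqrt ?_) (Real.sqrt_nonneg _)
  linarith [sqSum_nonneg h n ω]

/-- A pathwise form of the Davis inequality. -/
lemma abs_le_sqrt_sqSum_add (h : ℕ → Ω → ℝ) {ω : Ω} (h0 : h 0 ω = 0) (n : ℕ) :
    |h n ω| ≤ 6 * √(sqSum h n ω) + paraproduct (davisCoeff h) h n ω := by
  have key : √(sqSum h n ω + h n ω ^ 2)
      ≤ 6 * √(sqSum h n ω) + paraproduct (davisCoeff h) h n ω := by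
    induction n with
    | zero => simp [sqSum, h0]
    | succ n ih =>
      have hs := davis_step (h n ω) (h (n + 1) ω - h n ω) (Real.sqrt_nonneg (sqSum h n ω))
      rw [Real.sq_sqrt (sqSum_nonneg h n ω), ← sqSum_succ, add_sub_cancel] at hs
      rw [paraproduct_succ]
      simp only [davisCoeff] at ih ⊢
      linarith
  refine (Real.abs_le_sqrt ?_).trans key
  linarith [sqSum_nonneg h n ω]

/-- The coefficients in the pathwise maximal inequality. -/
def maxCoeff (h : ℕ → Ω → ℝ) (n : ℕ) (ω : Ω) : ℝ :=
  8 * h n ω - 4 * (runMax h n ω * sgn (h n ω))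

lemma abs_maxCoeff_le (h : ℕ → Ω → ℝ) (n : ℕ) (ω : Ω) :
    |maxCoeff h n ω| ≤ 12 * runMax h n ω := by
  refine (abs_sub _ _).trans ?_
  rw [abs_mul, abs_mul, abs_mul, abs_sgn, abs_runMax, mul_one, abs_of_pos (by norm_num : (0:ℝ) < 8),
    abs_of_pos (by norm_num : (0:ℝ) < 4)]
  linarith [abs_le_runMax_self h n ω]

/-- The square of the maximum is controlled by the square function, up to a transform. -/
lemma runMax_sq_le (h : ℕ → Ω → ℝ) {ω : Ω} (h0 : h 0 ω = 0) (n : ℕ) :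
    runMax h n ω ^ 2 ≤ 4 * sqSum h n ω + paraproduct (maxCoeff h) h n ω := by
  have h1 := runMax_rpow_le one_lt_two h n ω
  rw [show (2 : ℝ) - 1 = 1 by norm_num, Real.rpow_two] at h1
  simp only [Real.rpow_one] at h1
  have h2 := sq_eq_sqSum_add h n ω
  rw [h0] at h2
  have e : paraproduct (maxCoeff h) h n ω = 8 * paraproduct h h n ω
      - 4 * paraproduct (fun j ω => runMax h j ω * sgn (h j ω)) h n ω := by
    simp only [paraproduct, maxCoeff, Finset.mul_sum]
    rw [← Finset.sum_sub_distrib]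
    exact Finset.sum_congr rfl fun j _ => by ring
  rw [e]
  -- Four times Doob's pathwise inequality at p = 2, with 4 max|h| |h n| ≤ (max|h|)² + 4 (h n)² and
  -- the expansion of (h n)². This produces the 8 and the 4 in `maxCoeff`.
  nlinarith [sq_nonneg (runMax h n ω - 2 * |h n ω|), sq_abs (h n ω)]

lemma sqSum_paraproduct_le (a g : ℕ → Ω → ℝ) (n : ℕ) (ω : Ω) :
    sqSum (paraproduct a g) n ω ≤ runMax a n ω ^ 2 * sqSum g n ω := by
  simp only [sqSum, Finset.mul_sum]
  refine Finset.sum_le_sum fun j hj => ?_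
  rw [paraproduct_succ, add_sub_cancel_left, mul_pow]
  refine mul_le_mul_of_nonneg_right ?_ (sq_nonneg _)
  rw [← sq_abs]
  exact pow_le_pow_left₀ (abs_nonneg _) (abs_le_runMax a (Finset.mem_range.1 hj).le ω) 2

/-- Pathwise bound for a single paraproduct. -/
lemma abs_paraproduct_le (a g : ℕ → Ω → ℝ) (n : ℕ) (ω : Ω) :
    |paraproduct a g n ω| ≤ 6 * (runMax a n ω * √(sqSum g n ω))
      + paraproduct (fun j ω => davisCoeff (paraproduct a g) j ω * a j ω) g n ω := by
  have h1 := abs_le_sqrt_sqSum_add (paraproduct a g) (ω := ω) (by simp) n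
  have h2 := Real.sqrt_le_sqrt (sqSum_paraproduct_le a g n ω)
  rw [Real.sqrt_mul (sq_nonneg _), Real.sqrt_sq (runMax_nonneg a n ω)] at h2
  -- A transform of a transform of g is again a transform of g, with the product coefficients.
  have e : paraproduct (davisCoeff (paraproduct a g)) (paraproduct a g) n ω
      = paraproduct (fun j ω => davisCoeff (paraproduct a g) j ω * a j ω) g n ω := by
    refine Finset.sum_congr rfl fun j _ => ?_
    rw [paraproduct_succ]; ring
  rw [e] at h1
  linarith

end Pathwise

/-! ### Localized pieces -/

section Pieces

variable {Ω : Type*} {m : MeasurableSpace Ω} {μ : Measure Ω} {ℱ : Filtration ℕ m}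

/-- Exhibits the piece as a difference of two stopped processes, from which both its adaptedness and
its increments follow. -/
lemma localizedPiece_eq (f : ℕ → Ω → ℝ) {S T : Ω → ℕ} {ω : Ω} (h : S ω ≤ T ω) (n : ℕ) :
    localizedPiece f S T n ω = f (min n (T ω)) ω - f (min n (S ω)) ω := by
  rw [localizedPiece]
  rcases le_total n (S ω) with h1 | h1
  · rw [max_eq_right h1, min_eq_left h, min_eq_left h1, min_eq_left (h1.trans h)]; simp
  · rw [max_eq_left h1, min_eq_right h1]

lemma localizedPiece_zero (f : ℕ → Ω → ℝ) {S T : Ω → ℕ} {ω : Ω} (h : S ω ≤ T ω) :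
    localizedPiece f S T 0 ω = 0 := by
  rw [localizedPiece_eq f h]; simp

lemma localizedPiece_sub (f : ℕ → Ω → ℝ) {S T : Ω → ℕ} {ω : Ω} (h : S ω ≤ T ω) (n : ℕ) :
    localizedPiece f S T (n + 1) ω - localizedPiece f S T n ω
      = (if S ω ≤ n ∧ n < T ω then 1 else 0) * (f (n + 1) ω - f n ω) := by
  rw [localizedPiece_eq f h, localizedPiece_eq f h]
  split_ifs with h1
  · rw [min_eq_left (by omega), min_eq_right (by omega), min_eq_left (by omega),
      min_eq_right (by omega)]
    ring
  · rcases not_and_or.1 h1 with h2 | h2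
    · rw [min_eq_left (by omega), min_eq_left (by omega), min_eq_left (by omega),
        min_eq_left (by omega)]
      ring
    · rw [min_eq_right (by omega), min_eq_right (by omega), min_eq_right (by omega),
        min_eq_right (by omega)]
      ring

lemma abs_localizedPiece_le (f : ℕ → Ω → ℝ) {S T : Ω → ℕ} {ω : Ω} (h : S ω ≤ T ω) (n : ℕ) :
    |localizedPiece f S T n ω| ≤ 2 * runMax f n ω := by
  rw [localizedPiece_eq f h]
  refine (abs_sub _ _).trans ?_
  have h1 := abs_le_runMax f (min_le_left n (T ω)) ω
  have h2 := abs_le_runMax f (min_le_left n (S ω)) ω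
  linarith

lemma runMax_localizedPiece_le (f : ℕ → Ω → ℝ) {S T : Ω → ℕ} {ω : Ω} (h : S ω ≤ T ω) (n : ℕ) :
    runMax (localizedPiece f S T) n ω ≤ 2 * runMax f n ω := by
  refine runMax_le fun i hi => (abs_localizedPiece_le f h i).trans ?_
  have := runMax_mono f ω hi
  dsimp only at this
  linarith

lemma stronglyAdapted_localizedPiece {f : ℕ → Ω → ℝ} (hf : StronglyAdapted ℱ f) {S T : Ω → ℕ}
    (hS : IsStoppingTime ℱ (fun ω => (S ω : WithTop ℕ)))
    (hT : IsStoppingTime ℱ (fun ω => (T ω : WithTop ℕ))) (h : ∀ ω, S ω ≤ T ω) :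
    StronglyAdapted ℱ (localizedPiece f S T) := by
  have e : localizedPiece f S T = fun n => stoppedProcess f (fun ω => (T ω : WithTop ℕ)) n
      - stoppedProcess f (fun ω => (S ω : WithTop ℕ)) n := by
    ext n ω
    rw [localizedPiece_eq f (h ω)]
    have hmin : ∀ t : ℕ, (min (n : WithTop ℕ) (t : WithTop ℕ)).untopA = min n t := fun t => by
      have : min (n : WithTop ℕ) (t : WithTop ℕ) = ((min n t : ℕ) : WithTop ℕ) :=
        (WithTop.coe_min n t).symm
      rw [this]; rfl
    simp only [Pi.sub_apply, stoppedProcess]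
    rw [← hmin (T ω), ← hmin (S ω)]; rfl
  rw [e]
  exact fun n => (hf.stoppedProcess_of_discrete hT n).sub (hf.stoppedProcess_of_discrete hS n)

/-! ### Gluing coefficients along the intervals between stopping times -/

/-- The process which equals `c k` on the interval `T k ≤ j < T (k + 1)`, for `k < K`. -/
def glue (T : ℕ → Ω → ℕ) (c : ℕ → ℕ → Ω → ℝ) (K j : ℕ) (ω : Ω) : ℝ :=
  ∑ k ∈ Finset.range K, (if T k ω ≤ j ∧ j < T (k + 1) ω then 1 else 0) * c k j ω

/-- The intervals [T_k, T_{k+1}) with k < K partition [T_0, T_K). -/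
lemma sum_indicator_eq {T : ℕ → Ω → ℕ} {ω : Ω} (hT : ∀ k, T k ω ≤ T (k + 1) ω) (K j : ℕ) :
    ∑ k ∈ Finset.range K, (if T k ω ≤ j ∧ j < T (k + 1) ω then (1 : ℝ) else 0)
      = if T 0 ω ≤ j ∧ j < T K ω then 1 else 0 := by
  induction K with
  | zero => simp
  | succ K ih =>
    have h1 := hT K
    have h2 : T 0 ω ≤ T K ω := monotone_nat_of_le_succ (f := fun k => T k ω) hT (Nat.zero_le K)
    rw [Finset.sum_range_succ, ih]
    split_ifs <;> first | omega | simp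

lemma sum_indicator_le_one {T : ℕ → Ω → ℕ} {ω : Ω} (hT : ∀ k, T k ω ≤ T (k + 1) ω) (K j : ℕ) :
    ∑ k ∈ Finset.range K, (if T k ω ≤ j ∧ j < T (k + 1) ω then (1 : ℝ) else 0) ≤ 1 := by
  rw [sum_indicator_eq hT]
  split_ifs <;> norm_num

lemma abs_glue_le {T : ℕ → Ω → ℕ} {ω : Ω} (hT : ∀ k, T k ω ≤ T (k + 1) ω)
    {c : ℕ → ℕ → Ω → ℝ} {K j : ℕ} {b : ℝ} (hb : ∀ k, |c k j ω| ≤ b) :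
    |glue T c K j ω| ≤ b := by
  have hb0 : 0 ≤ b := (abs_nonneg _).trans (hb 0)
  refine (Finset.abs_sum_le_sum_abs _ _).trans ?_
  calc _ ≤ ∑ k ∈ Finset.range K, (if T k ω ≤ j ∧ j < T (k + 1) ω then (1 : ℝ) else 0) * b := by
        refine Finset.sum_le_sum fun k _ => ?_
        rw [abs_mul]
        split_ifs <;> simp [hb k]
    _ ≤ 1 * b := by
        rw [← Finset.sum_mul]
        exact mul_le_mul_of_nonneg_right (sum_indicator_le_one hT K j) hb0
    _ = b := one_mul b

lemma stronglyAdapted_glue {T : ℕ → Ω → ℕ}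
    (hT : ∀ k, IsStoppingTime ℱ (fun ω => (T k ω : WithTop ℕ))) {c : ℕ → ℕ → Ω → ℝ}
    (hc : ∀ k, StronglyAdapted ℱ (c k)) (K : ℕ) : StronglyAdapted ℱ (glue T c K) := by
  intro j
  refine Measurable.stronglyMeasurable ?_
  refine Finset.measurable_fun_sum _ fun k _ => ?_
  refine Measurable.mul ?_ (hc k j).measurable
  refine Measurable.ite ?_ measurable_const measurable_const
  have h1 : MeasurableSet[ℱ j] {ω | T k ω ≤ j} := by
    simpa using (hT k).measurableSet_le j
  have h2 : MeasurableSet[ℱ j] {ω | j < T (k + 1) ω} := by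
    simpa using (hT (k + 1)).measurableSet_gt j
  exact h1.inter h2

/-- Increments of the k-th piece are those of g restricted to the k-th interval, so exchanging the
sums over k and over time turns the whole family into one scalar transform. -/
lemma sum_paraproduct_localizedPiece {T : ℕ → Ω → ℕ} {ω : Ω} (hT : ∀ k, T k ω ≤ T (k + 1) ω)
    (c : ℕ → ℕ → Ω → ℝ) (g : ℕ → Ω → ℝ) (K n : ℕ) :
    ∑ k ∈ Finset.range K, paraproduct (c k) (localizedPiece g (T k) (T (k + 1))) n ω
      = paraproduct (glue T c K) g n ω := by
  simp only [paraproduct, glue, Finset.sum_mul]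
  rw [Finset.sum_comm]
  refine Finset.sum_congr rfl fun j _ => Finset.sum_congr rfl fun k _ => ?_
  rw [localizedPiece_sub g (hT k)]
  ring

lemma sum_sqSum_localizedPiece_le {T : ℕ → Ω → ℕ} {ω : Ω} (hT : ∀ k, T k ω ≤ T (k + 1) ω)
    (g : ℕ → Ω → ℝ) (K n : ℕ) :
    ∑ k ∈ Finset.range K, sqSum (localizedPiece g (T k) (T (k + 1))) n ω ≤ sqSum g n ω := by
  simp only [sqSum]
  rw [Finset.sum_comm]
  refine Finset.sum_le_sum fun j _ => ?_
  calc _ = (∑ k ∈ Finset.range K, (if T k ω ≤ j ∧ j < T (k + 1) ω then (1 : ℝ) else 0))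
        * (g (j + 1) ω - g j ω) ^ 2 := by
        rw [Finset.sum_mul]
        refine Finset.sum_congr rfl fun k _ => ?_
        rw [localizedPiece_sub g (hT k)]
        split_ifs <;> ring
    _ ≤ 1 * _ := mul_le_mul_of_nonneg_right (sum_indicator_le_one hT K j) (sq_nonneg _)
    _ = _ := one_mul _

/-- The coefficients of the transform of `g` in the bound for `∑ |Π(f⁽ᵏ⁾, g⁽ᵏ⁾)|`. -/
def davisGlue (T : ℕ → Ω → ℕ) (f g : ℕ → Ω → ℝ) (K : ℕ) : ℕ → Ω → ℝ :=
  glue T (fun k j ω => davisCoeff (paraproduct (localizedPiece f (T k) (T (k + 1)))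
    (localizedPiece g (T k) (T (k + 1)))) j ω * localizedPiece f (T k) (T (k + 1)) j ω) K

/-- The coefficients of the transform of `f` in the bound for `∑ (max |f⁽ᵏ⁾|)²`. -/
def maxGlue (T : ℕ → Ω → ℕ) (f : ℕ → Ω → ℝ) (K : ℕ) : ℕ → Ω → ℝ :=
  glue T (fun k => maxCoeff (localizedPiece f (T k) (T (k + 1)))) K

/-- The pathwise reduction to two scalar transforms and the square functions. -/
lemma sum_abs_paraproduct_le {T : ℕ → Ω → ℕ} {ω : Ω} (hT : ∀ k, T k ω ≤ T (k + 1) ω)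
    (f g : ℕ → Ω → ℝ) (K n : ℕ) :
    ∑ k ∈ Finset.range K, |paraproduct (localizedPiece f (T k) (T (k + 1)))
        (localizedPiece g (T k) (T (k + 1))) n ω|
      ≤ 6 * (√(4 * sqSum f n ω + |paraproduct (maxGlue T f K) f n ω|) * √(sqSum g n ω))
        + |paraproduct (davisGlue T f g K) g n ω| := by
  set fk : ℕ → ℕ → Ω → ℝ := fun k => localizedPiece f (T k) (T (k + 1))
  set gk : ℕ → ℕ → Ω → ℝ := fun k => localizedPiece g (T k) (T (k + 1))
  have hF : ∑ k ∈ Finset.range K, runMax (fk k) n ω ^ 2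
      ≤ 4 * sqSum f n ω + |paraproduct (maxGlue T f K) f n ω| := by
    calc _ ≤ ∑ k ∈ Finset.range K, (4 * sqSum (fk k) n ω
          + paraproduct (maxCoeff (fk k)) (fk k) n ω) :=
          Finset.sum_le_sum fun k _ => runMax_sq_le (fk k) (localizedPiece_zero f (hT k)) n
      _ = 4 * ∑ k ∈ Finset.range K, sqSum (fk k) n ω
          + paraproduct (maxGlue T f K) f n ω := by
          rw [Finset.sum_add_distrib, ← Finset.mul_sum, maxGlue,
            ← sum_paraproduct_localizedPiece hT]
      _ ≤ _ := by
          have := sum_sqSum_localizedPiece_le hT f K n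
          have := le_abs_self (paraproduct (maxGlue T f K) f n ω)
          linarith
  have hG : ∑ k ∈ Finset.range K, √(sqSum (gk k) n ω) ^ 2 ≤ sqSum g n ω := by
    refine le_trans (le_of_eq ?_) (sum_sqSum_localizedPiece_le hT g K n)
    exact Finset.sum_congr rfl fun k _ => Real.sq_sqrt (sqSum_nonneg _ _ _)
  -- Cauchy–Schwarz in k separates the maxima of the pieces of f from the square functions of the
  -- pieces of g.
  have hCS := Real.sum_mul_le_sqrt_mul_sqrt (Finset.range K) (fun k => runMax (fk k) n ω)
    (fun k => √(sqSum (gk k) n ω))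
  have hCS' := hCS.trans (mul_le_mul (Real.sqrt_le_sqrt hF) (Real.sqrt_le_sqrt hG)
    (Real.sqrt_nonneg _) (Real.sqrt_nonneg _))
  calc _ ≤ ∑ k ∈ Finset.range K, (6 * (runMax (fk k) n ω * √(sqSum (gk k) n ω))
        + paraproduct (fun j ω => davisCoeff (paraproduct (fk k) (gk k)) j ω * fk k j ω)
          (gk k) n ω) := Finset.sum_le_sum fun k _ => abs_paraproduct_le (fk k) (gk k) n ω
    _ = 6 * ∑ k ∈ Finset.range K, runMax (fk k) n ω * √(sqSum (gk k) n ω)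
        + paraproduct (davisGlue T f g K) g n ω := by
        rw [Finset.sum_add_distrib, ← Finset.mul_sum, davisGlue,
          ← sum_paraproduct_localizedPiece hT]
    _ ≤ _ := by
        have := le_abs_self (paraproduct (davisGlue T f g K) g n ω)
        linarith

lemma abs_davisGlue_le {T : ℕ → Ω → ℕ} {ω : Ω} (hT : ∀ k, T k ω ≤ T (k + 1) ω)
    (f g : ℕ → Ω → ℝ) (K j : ℕ) : |davisGlue T f g K j ω| ≤ 2 * runMax f j ω := by
  refine abs_glue_le hT fun k => ?_
  rw [abs_mul]
  refine (mul_le_of_le_one_left (abs_nonneg _) (abs_davisCoeff_le _ _ _)).trans ?_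
  exact abs_localizedPiece_le f (hT k) j

lemma abs_maxGlue_le {T : ℕ → Ω → ℕ} {ω : Ω} (hT : ∀ k, T k ω ≤ T (k + 1) ω)
    (f : ℕ → Ω → ℝ) (K j : ℕ) : |maxGlue T f K j ω| ≤ 24 * runMax f j ω := by
  refine abs_glue_le hT fun k => (abs_maxCoeff_le _ _ _).trans ?_
  have := runMax_localizedPiece_le f (hT k) j
  linarith

lemma measurable_sqSum {h : ℕ → Ω → ℝ} (hh : StronglyAdapted ℱ h) (n : ℕ) :
    Measurable[ℱ n] (sqSum h n) := by
  refine Finset.measurable_fun_sum _ fun j hj => ?_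
  have hj' := Finset.mem_range.1 hj
  exact (((hh (j + 1)).mono (ℱ.mono hj')).measurable.sub
    ((hh j).mono (ℱ.mono hj'.le)).measurable).pow_const 2

lemma stronglyAdapted_davisGlue {T : ℕ → Ω → ℕ} (hTm : ∀ k ω, T k ω ≤ T (k + 1) ω)
    (hT : ∀ k, IsStoppingTime ℱ (fun ω => (T k ω : WithTop ℕ))) {f g : ℕ → Ω → ℝ}
    (hf : StronglyAdapted ℱ f) (hg : StronglyAdapted ℱ g) (K : ℕ) :
    StronglyAdapted ℱ (davisGlue T f g K) := by
  refine stronglyAdapted_glue hT (fun k j => ?_) K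
  have hfk := stronglyAdapted_localizedPiece hf (hT k) (hT (k + 1)) (hTm k)
  have hgk := stronglyAdapted_localizedPiece hg (hT k) (hT (k + 1)) (hTm k)
  have hP := paraproduct_stronglyAdapted hfk hgk
  refine (Measurable.mul ?_ (hfk j).measurable).stronglyMeasurable
  exact (hP j).measurable.div
    ((measurable_sqSum hP j).add ((hP j).measurable.pow_const 2)).sqrt

lemma stronglyAdapted_maxGlue {T : ℕ → Ω → ℕ} (hTm : ∀ k ω, T k ω ≤ T (k + 1) ω)
    (hT : ∀ k, IsStoppingTime ℱ (fun ω => (T k ω : WithTop ℕ))) {f : ℕ → Ω → ℝ}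
    (hf : StronglyAdapted ℱ f) (K : ℕ) : StronglyAdapted ℱ (maxGlue T f K) := by
  refine stronglyAdapted_glue hT (fun k j => ?_) K
  have hfk := stronglyAdapted_localizedPiece hf (hT k) (hT (k + 1)) (hTm k)
  exact (((hfk j).measurable.const_mul 8).sub
    (((runMax_stronglyAdapted hfk j).measurable.mul
      (measurable_sgn.comp (hfk j).measurable)).const_mul 4)).stronglyMeasurable

end Pieces

end

noncomputable section

/-! ### Norm bounds for the sum of the localized paraproducts -/

section Norms

/-- The transform bound with the increasing majorant A = c max|f|, the only shape needed for the
glued coefficients. -/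
lemma lpn_paraproduct_le_of_transformBound {p q r : ℝ} (hB : TransformBound.{u} p q r) :
    ∃ C : ℝ≥0, ∀ (Ω : Type u) (m : MeasurableSpace Ω) (μ : Measure Ω) (_ : IsProbabilityMeasure μ)
      (ℱ : Filtration ℕ m) (f g b : ℕ → Ω → ℝ) (c : ℝ≥0), Martingale f ℱ μ → Martingale g ℱ μ →
      (∀ n, InLp μ p (f n)) → (∀ n, InLp μ q (g n)) → StronglyAdapted ℱ b →
      (∀ n ω, |b n ω| ≤ c * runMax f n ω) → ∀ n,
      lpn μ r (paraproduct b g n) ≤ C * c * (lpn μ p (runMax f n) * lpn μ q (runMax g n)) := by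
  obtain ⟨C, hC⟩ := hB
  refine ⟨C, fun Ω m μ _ ℱ f g b c hf hg hfp hgq hb hbf n => ?_⟩
  have d : TransformData μ ℱ p q g b (fun n ω => (c : ℝ) * runMax f n ω) :=
    { martingale := hg
      inLp_g := hgq
      adapted_a := hb
      adapted_A := fun n => (runMax_stronglyAdapted hf.stronglyAdapted n).const_mul _
      mono := fun ω i j hij => mul_le_mul_of_nonneg_left (runMax_mono f ω hij) c.2
      abs_le := hbf
      inLp_A := fun n => (InLp.runMax hfp n).const_mul _ }
  calc lpn μ r (paraproduct b g n) ≤ lpn μ r (runMax (paraproduct b g) n) :=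
        lpn_mono (ae_of_all _ (abs_le_runMax_self _ n))
    _ ≤ C * (lpn μ p (fun ω => (c : ℝ) * runMax f n ω) * lpn μ q (runMax g n)) :=
        hC Ω m μ inferInstance ℱ g b _ d n
    _ = _ := by rw [lpn_const_mul]; ring

/-- The constant 1 + D replaces √D, since D ≤ (1 + D)². -/
lemma lpn_sqrt_le {Ω : Type*} {m : MeasurableSpace Ω} {μ : Measure Ω} {q : ℝ} {Y : Ω → ℝ}
    (hY : ∀ ω, 0 ≤ Y ω) {D : ℝ≥0} {x : ℝ≥0∞} (h : lpn μ (q / 2) Y ≤ D * x ^ 2) :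
    lpn μ q (fun ω => √(Y ω)) ≤ (1 + D : ℝ≥0) * x := by
  refine ennreal_le_of_sq_le ?_
  rw [← lpn_sq]
  have e : (fun ω => √(Y ω) ^ 2) = Y := by ext ω; exact Real.sq_sqrt (hY ω)
  rw [e, mul_pow]
  refine h.trans (mul_le_mul_left ?_ _)
  have : D ≤ (1 + D) ^ 2 := by
    calc D ≤ 1 + D := le_add_self
      _ ≤ _ := le_self_pow₀ le_self_add two_ne_zero
  exact_mod_cast this

/-- The square function estimate, including an additional transform of the martingale. -/
lemma lpn_sqrt_sqSum_le {q : ℝ} (hq : 1 < q) :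
    ∃ C : ℝ≥0, ∀ (Ω : Type u) (m : MeasurableSpace Ω) (μ : Measure Ω) (_ : IsProbabilityMeasure μ)
      (ℱ : Filtration ℕ m) (g b : ℕ → Ω → ℝ), Martingale g ℱ μ →
      (∀ n, InLp μ q (g n)) → StronglyAdapted ℱ b →
      (∀ n ω, |b n ω| ≤ 24 * runMax g n ω) → ∀ n,
      lpn μ q (fun ω => √(4 * sqSum g n ω + |paraproduct b g n ω|)) ≤ C * lpn μ q (runMax g n) := by
  have hq0 : 0 < q := by linarith
  have hT : q.HolderTriple q (q / 2) := ⟨by field_simp; norm_num, hq0, hq0⟩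
  obtain ⟨C, hC⟩ := lpn_paraproduct_le_of_transformBound (transformBound.{u} hq hT)
  set K := addConst (q / 2) with hK
  refine ⟨1 + K * (4 + K * (C * 1 * 8 + C * 24)), fun Ω m μ _ ℱ g b hg hgq hb hbg n => ?_⟩
  have hgad := hg.stronglyAdapted
  refine lpn_sqrt_le (fun ω => by have := sqSum_nonneg g n ω; positivity) ?_
  set G := lpn μ q (runMax g n) with hG
  have b₁ := hC Ω m μ inferInstance ℱ g g g 1 hg hg hgq hgq hgad
    (fun n ω => by rw [NNReal.coe_one, one_mul]; exact abs_le_runMax_self g n ω) n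
  have b₂ := hC Ω m μ inferInstance ℱ g g b 24 hg hg hgq hgq hb hbg n
  have s₁ : AEStronglyMeasurable (paraproduct g g n) μ :=
    StronglyAdapted.aesm (paraproduct_stronglyAdapted hgad hgad) n
  have s₂ : AEStronglyMeasurable (paraproduct b g n) μ :=
    StronglyAdapted.aesm (paraproduct_stronglyAdapted hb hgad) n
  have s₁' : AEStronglyMeasurable (fun ω => ((8 : ℝ≥0) : ℝ) * |paraproduct g g n ω|) μ :=
    s₁.norm.const_mul _
  have s₂' : AEStronglyMeasurable (fun ω => |paraproduct b g n ω|) μ := s₂.norm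
  have s₀ : AEStronglyMeasurable (fun ω => ((4 : ℝ≥0) : ℝ) * g n ω ^ 2) μ :=
    ((hgq n).1.pow 2).const_mul _
  -- Four times the identity g_n² = g_0² + S + 2Π(g, g), with S the sum of squared increments.
  have path : ∀ ω, |(4 * sqSum g n ω + |paraproduct b g n ω|)| ≤ ((4 : ℝ≥0) : ℝ) * g n ω ^ 2
      + (((8 : ℝ≥0) : ℝ) * |paraproduct g g n ω| + |paraproduct b g n ω|) := fun ω => by
    have h1 := sqSum_nonneg g n ω
    rw [abs_of_nonneg (by positivity)]
    have h2 := sq_eq_sqSum_add g n ω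
    have h3 := neg_abs_le (paraproduct g g n ω)
    have h4 := sq_nonneg (g 0 ω)
    change _ ≤ 4 * _ + (8 * _ + _)
    linarith
  have hgG : lpn μ q (g n) ≤ G := lpn_mono (ae_of_all _ (abs_le_runMax_self g n))
  calc lpn μ (q / 2) (fun ω => 4 * sqSum g n ω + |paraproduct b g n ω|)
      ≤ K * (lpn μ (q / 2) (fun ω => ((4 : ℝ≥0) : ℝ) * g n ω ^ 2)
        + K * (lpn μ (q / 2) (fun ω => ((8 : ℝ≥0) : ℝ) * |paraproduct g g n ω|)
          + lpn μ (q / 2) (fun ω => |paraproduct b g n ω|))) :=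
        (lpn_mono (ae_of_all _ path)).trans ((lpn_add_le (q / 2) s₀ (s₁'.add s₂')).trans
          (mul_le_mul_right (add_le_add le_rfl (lpn_add_le (q / 2) s₁' s₂')) _))
    _ = K * ((4 : ℝ≥0) * lpn μ q (g n) ^ 2
        + K * ((8 : ℝ≥0) * lpn μ (q / 2) (paraproduct g g n)
          + lpn μ (q / 2) (paraproduct b g n))) := by
        rw [lpn_const_mul, lpn_sq, lpn_const_mul, lpn_abs, lpn_abs]
    _ ≤ K * ((4 : ℝ≥0) * G ^ 2 + K * ((8 : ℝ≥0) * (C * (1 : ℝ≥0) * (G * G))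
          + C * (24 : ℝ≥0) * (G * G))) := by gcongr
    _ = _ := by push_cast; ring

/-- The bound for finitely many localized paraproducts. -/
theorem lpn_sum_paraproduct_le {p q r : ℝ} (hp : 1 < p) (hq : 1 < q) (hT : p.HolderTriple q r) :
    ∃ C : ℝ≥0, ∀ (Ω : Type u) (m : MeasurableSpace Ω) (μ : Measure Ω) (_ : IsProbabilityMeasure μ)
      (ℱ : Filtration ℕ m) (T : ℕ → Ω → ℕ),
      (∀ k, IsStoppingTime ℱ (fun ω => (T k ω : WithTop ℕ))) →
      (∀ k ω, T k ω ≤ T (k + 1) ω) → ∀ f g : ℕ → Ω → ℝ, Martingale f ℱ μ → Martingale g ℱ μ →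
      (∀ n, InLp μ p (f n)) → (∀ n, InLp μ q (g n)) → ∀ K n : ℕ,
      lpn μ r (fun ω => ∑ k ∈ Finset.range K, |paraproduct (localizedPiece f (T k) (T (k + 1)))
        (localizedPiece g (T k) (T (k + 1))) n ω|) ≤ C * (lpn μ p (f n) * lpn μ q (g n)) := by
  obtain ⟨C₁, hC₁⟩ := lpn_paraproduct_le_of_transformBound (transformBound.{u} hq hT)
  obtain ⟨C₂, hC₂⟩ := lpn_sqrt_sqSum_le.{u} hp
  obtain ⟨C₃, hC₃⟩ := lpn_sqrt_sqSum_le.{u} hq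
  set E : ℝ≥0 := (p / (p - 1)).toNNReal * (q / (q - 1)).toNNReal with hE
  refine ⟨addConst r * (6 * (C₂ * C₃) + C₁ * 2) * E,
    fun Ω m μ _ ℱ T hT' hTm f g hf hg hfp hgq K n => ?_⟩
  have hfad := hf.stronglyAdapted
  have hgad := hg.stronglyAdapted
  have had := stronglyAdapted_davisGlue hTm hT' hfad hgad K
  have had' := stronglyAdapted_maxGlue hTm hT' hfad K
  set F := lpn μ p (runMax f n) with hF
  set G := lpn μ q (runMax g n) with hG
  have b₁ := hC₁ Ω m μ inferInstance ℱ f g _ 2 hf hg hfp hgq had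
    (fun j ω => abs_davisGlue_le (fun k => hTm k ω) f g K j) n
  have b₂ := hC₂ Ω m μ inferInstance ℱ f _ hf hfp had'
    (fun j ω => abs_maxGlue_le (fun k => hTm k ω) f K j) n
  -- With zero extra coefficients this is the plain square function estimate for g.
  have b₃ := hC₃ Ω m μ inferInstance ℱ g (fun _ _ => 0) hg hgq
    (fun _ => stronglyMeasurable_const) (fun j ω => by
      have := runMax_nonneg g j ω
      rw [abs_zero]; positivity) n
  set X : Ω → ℝ := fun ω => √(4 * sqSum f n ω + |paraproduct (maxGlue T f K) f n ω|)
  set Y : Ω → ℝ := fun ω => √(4 * sqSum g n ω + |paraproduct (fun _ _ => 0) g n ω|)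
  have sY : AEStronglyMeasurable Y μ :=
    ((((measurable_sqSum hgad n).mono (ℱ.le n) le_rfl).const_mul 4).add
      ((paraproduct_stronglyAdapted (fun _ => stronglyMeasurable_const) hgad n).mono
        (ℱ.le n)).norm.measurable).sqrt.aestronglyMeasurable
  have sX : AEStronglyMeasurable X μ :=
    ((((measurable_sqSum hfad n).mono (ℱ.le n) le_rfl).const_mul 4).add
      ((paraproduct_stronglyAdapted had' hfad n).mono
        (ℱ.le n)).norm.measurable).sqrt.aestronglyMeasurable
  have sN : AEStronglyMeasurable (fun ω => |paraproduct (davisGlue T f g K) g n ω|) μ :=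
    AEStronglyMeasurable.norm (StronglyAdapted.aesm (paraproduct_stronglyAdapted had hgad) n)
  have path : ∀ ω, |(∑ k ∈ Finset.range K, |paraproduct (localizedPiece f (T k) (T (k + 1)))
      (localizedPiece g (T k) (T (k + 1))) n ω|)|
      ≤ ((6 : ℝ≥0) : ℝ) * (X ω * Y ω) + |paraproduct (davisGlue T f g K) g n ω| := fun ω => by
    rw [abs_of_nonneg (Finset.sum_nonneg fun _ _ => abs_nonneg _)]
    refine (sum_abs_paraproduct_le (fun k => hTm k ω) f g K n).trans ?_
    have h1 : √(sqSum g n ω) ≤ Y ω := Real.sqrt_le_sqrt (by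
      have := sqSum_nonneg g n ω
      have := abs_nonneg (paraproduct (fun _ _ => 0) g n ω)
      linarith)
    have h2 : 0 ≤ X ω := Real.sqrt_nonneg _
    have h3 := mul_le_mul_of_nonneg_left h1 h2
    change 6 * (X ω * _) + _ ≤ 6 * (X ω * Y ω) + _
    linarith
  have dF := lpn_runMax_le hp hf hfp n
  have dG := lpn_runMax_le hq hg hgq n
  calc _ ≤ addConst r * (lpn μ r (fun ω => ((6 : ℝ≥0) : ℝ) * (X ω * Y ω))
        + lpn μ r (fun ω => |paraproduct (davisGlue T f g K) g n ω|)) :=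
        (lpn_mono (ae_of_all _ path)).trans (lpn_add_le r ((sX.mul sY).const_mul _) sN)
    _ ≤ addConst r * ((6 : ℝ≥0) * ((C₂ * F) * (C₃ * G)) + C₁ * (2 : ℝ≥0) * (F * G)) := by
        rw [lpn_const_mul, lpn_abs]
        gcongr
        exact (lpn_mul_le hT sX sY).trans (mul_le_mul' b₂ b₃)
    _ = addConst r * (6 * (C₂ * C₃) + C₁ * 2) * (F * G) := by push_cast; ring
    _ ≤ addConst r * (6 * (C₂ * C₃) + C₁ * 2) *
        ((ENNReal.ofReal (p / (p - 1)) * lpn μ p (f n)) *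
          (ENNReal.ofReal (q / (q - 1)) * lpn μ q (g n))) := by gcongr
    _ = _ := by
        rw [hE]
        push_cast
        simp only [ENNReal.ofReal]
        ring

end Norms

/-! ### The terminal values -/

section Terminal

variable {Ω : Type*}

lemma paraproduct_localizedPiece_eq_of_le (a g : ℕ → Ω → ℝ) {S T : Ω → ℕ} {ω : Ω}
    (h : S ω ≤ T ω) {N n : ℕ} (hN : T ω ≤ N) (hn : N ≤ n) :
    paraproduct a (localizedPiece g S T) n ω = paraproduct a (localizedPiece g S T) N ω := by
  induction n, hn using Nat.le_induction with
  | base => rfl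
  | succ n hn ih =>
    rw [paraproduct_succ, ih, localizedPiece_sub g h, if_neg (by omega)]
    ring

lemma paraproductInfty_localizedPiece (a g : ℕ → Ω → ℝ) {S T : Ω → ℕ} {ω : Ω}
    (h : S ω ≤ T ω) {N : ℕ} (hN : T ω ≤ N) :
    paraproductInfty a (localizedPiece g S T) ω = paraproduct a (localizedPiece g S T) N ω := by
  refine Tendsto.limUnder_eq (tendsto_const_nhds.congr' ?_)
  filter_upwards [eventually_ge_atTop N] with n hn
  exact (paraproduct_localizedPiece_eq_of_le a g h hN hn).symm

lemma localizedPiece_eq_zero {f : ℕ → Ω → ℝ} {ω : Ω} (hf : ∀ n, f n ω = 0) (S T : Ω → ℕ) (n : ℕ) :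
    localizedPiece f S T n ω = 0 := by
  simp [localizedPiece, hf]

/-- Monotone convergence for the r-th powers of the partial sums; it works for every r > 0, with no
triangle inequality in L^r. -/
lemma eLpNorm_tsum_enorm_le {m : MeasurableSpace Ω} {μ : Measure Ω} {r : ℝ} (hr : 0 < r)
    {X : ℕ → Ω → ℝ} (hX : ∀ k, AEStronglyMeasurable (X k) μ) {c : ℝ≥0∞}
    (h : ∀ K, lpn μ r (fun ω => ∑ k ∈ Finset.range K, |X k ω|) ≤ c) :
    eLpNorm (fun ω => ∑' k, ‖X k ω‖ₑ) (ENNReal.ofReal r) μ ≤ c := by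
  have hr0 : ENNReal.ofReal r ≠ 0 := by simpa using hr
  have hpart : ∀ K, ∫⁻ ω, (∑ k ∈ Finset.range K, ‖X k ω‖ₑ) ^ r ∂μ ≤ c ^ r := by
    intro K
    have h1 := h K
    rw [lpn, eLpNorm_eq_lintegral_rpow_enorm_toReal hr0 ENNReal.ofReal_ne_top,
      ENNReal.toReal_ofReal hr.le, one_div, ENNReal.rpow_inv_le_iff hr] at h1
    refine le_trans (le_of_eq (lintegral_congr fun ω => ?_)) h1
    congr 1
    rw [Real.enorm_eq_ofReal (Finset.sum_nonneg fun _ _ => abs_nonneg _),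
      ENNReal.ofReal_sum_of_nonneg fun _ _ => abs_nonneg _]
    exact Finset.sum_congr rfl fun k _ => by rw [← Real.norm_eq_abs, ofReal_norm]
  rw [eLpNorm_eq_lintegral_rpow_enorm_toReal hr0 ENNReal.ofReal_ne_top,
    ENNReal.toReal_ofReal hr.le, one_div, ENNReal.rpow_inv_le_iff hr]
  have hsup : ∀ ω, ‖∑' k, ‖X k ω‖ₑ‖ₑ ^ r = ⨆ K, (∑ k ∈ Finset.range K, ‖X k ω‖ₑ) ^ r := by
    intro ω
    rw [enorm_eq_self, ENNReal.tsum_eq_iSup_nat]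
    exact (ENNReal.orderIsoRpow r hr).map_iSup _
  simp only [hsup]
  rw [lintegral_iSup']
  · exact iSup_le hpart
  · intro K
    exact (Finset.aemeasurable_fun_sum _ fun k _ => (hX k).enorm).pow_const r
  · refine ae_of_all _ fun ω i j hij => ?_
    exact ENNReal.rpow_le_rpow (Finset.sum_le_sum_of_subset (Finset.range_mono hij)) hr.le

end Terminal

end

/-! ### The main theorem: degenerate norms and passage to the infinite sum -/

theorem proposition3p1 (p q r : ℝ) (hp : 1 < p) (hq : 1 < q) (hr : 1 / 2 < r)
    (hpqr : 1 / p + 1 / q = 1 / r) :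
    ∃ C : ℝ≥0, ∀ (Ω : Type*) (m : MeasurableSpace Ω) (μ : Measure Ω) (_ : IsProbabilityMeasure μ)
      (ℱ : Filtration ℕ m) (T : ℕ → Ω → ℕ)
      (_ : ∀ k, IsStoppingTime ℱ (fun ω => (T k ω : WithTop ℕ)))
      (_ : ∀ k, ∃ N : ℕ, ∀ ω, T k ω ≤ N)
      (_ : ∀ k ω, T k ω ≤ T (k + 1) ω)
      (f g : ℕ → Ω → ℝ) (_ : Martingale f ℱ μ) (_ : Martingale g ℱ μ),
      (∀ k, ∀ᶠ n in atTop, ∀ ω,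
        paraproduct (localizedPiece f (T k) (T (k + 1))) (localizedPiece g (T k) (T (k + 1))) n ω
          = paraproductInfty (localizedPiece f (T k) (T (k + 1)))
              (localizedPiece g (T k) (T (k + 1))) ω) ∧
      eLpNorm (fun ω => ∑' k, ‖paraproductInfty (localizedPiece f (T k) (T (k + 1)))
          (localizedPiece g (T k) (T (k + 1))) ω‖ₑ) (ENNReal.ofReal r) μ
        ≤ C * processLpNorm f (ENNReal.ofReal p) μ * processLpNorm g (ENNReal.ofReal q) μ := by
  have hT : p.HolderTriple q r := ⟨by simpa using hpqr, by linarith, by linarith⟩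
  obtain ⟨C, hC⟩ := lpn_sum_paraproduct_le hp hq hT
  -- The constant is made nonzero so that the right side is ∞ when one norm is infinite and the
  -- other nonzero.
  refine ⟨C + 1, fun Ω m μ _ ℱ T hst hbd hmono f g hf hg => ⟨fun k => ?_, ?_⟩⟩
  · obtain ⟨N, hN⟩ := hbd (k + 1)
    filter_upwards [eventually_ge_atTop N] with n hn ω
    rw [paraproductInfty_localizedPiece _ g (hmono k ω) ((hN ω).trans hn)]
  set P : ℕ → Ω → ℝ := fun k => paraproductInfty (localizedPiece f (T k) (T (k + 1)))
    (localizedPiece g (T k) (T (k + 1)))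
  set F := processLpNorm f (ENNReal.ofReal p) μ with hF
  set G := processLpNorm g (ENNReal.ofReal q) μ with hG
  have hp0 : ENNReal.ofReal p ≠ 0 := by simpa using by linarith
  have hq0 : ENNReal.ofReal q ≠ 0 := by simpa using by linarith
  have hfm : ∀ n, AEStronglyMeasurable (f n) μ := fun n => (hf.integrable n).1
  have hgm : ∀ n, AEStronglyMeasurable (g n) μ := fun n => (hg.integrable n).1
  have hfF : ∀ n, eLpNorm (f n) (ENNReal.ofReal p) μ ≤ F := fun n =>
    le_iSup (fun n => eLpNorm (f n) (ENNReal.ofReal p) μ) n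
  have hgG : ∀ n, eLpNorm (g n) (ENNReal.ofReal q) μ ≤ G := fun n =>
    le_iSup (fun n => eLpNorm (g n) (ENNReal.ofReal q) μ) n
  have hzero : (∀ᵐ ω ∂μ, ∀ k, P k ω = 0) →
      eLpNorm (fun ω => ∑' k, ‖P k ω‖ₑ) (ENNReal.ofReal r) μ ≤ (C + 1 : ℝ≥0) * F * G := fun h => by
    have : (fun ω => ∑' k, ‖P k ω‖ₑ) =ᵐ[μ] fun _ => 0 := by
      filter_upwards [h] with ω hω
      simp [hω]
    rw [eLpNorm_congr_ae this]
    simp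
  -- If one norm vanishes the right side is 0 even when the other is ∞, so the left side has to be
  -- shown to vanish directly.
  by_cases hF0 : F = 0
  · refine hzero ?_
    have h0 : ∀ n, ∀ᵐ ω ∂μ, f n ω = 0 := fun n =>
      (eLpNorm_eq_zero_iff (hfm n) hp0).1 (le_antisymm ((hfF n).trans hF0.le) bot_le)
    filter_upwards [ae_all_iff.2 h0] with ω hω k
    obtain ⟨N, hN⟩ := hbd (k + 1)
    simp only [P]
    rw [paraproductInfty_localizedPiece _ g (hmono k ω) (hN ω)]
    simp [paraproduct, localizedPiece_eq_zero hω]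
  by_cases hG0 : G = 0
  · refine hzero ?_
    have h0 : ∀ n, ∀ᵐ ω ∂μ, g n ω = 0 := fun n =>
      (eLpNorm_eq_zero_iff (hgm n) hq0).1 (le_antisymm ((hgG n).trans hG0.le) bot_le)
    filter_upwards [ae_all_iff.2 h0] with ω hω k
    obtain ⟨N, hN⟩ := hbd (k + 1)
    simp only [P]
    rw [paraproductInfty_localizedPiece _ g (hmono k ω) (hN ω)]
    simp [paraproduct, localizedPiece_eq_zero hω]
  have hC0 : ((C + 1 : ℝ≥0) : ℝ≥0∞) ≠ 0 := by
    exact ENNReal.coe_ne_zero.2 (by positivity)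
  by_cases hFt : F = ∞
  · rw [hFt, ENNReal.mul_top hC0, ENNReal.top_mul hG0]; exact le_top
  by_cases hGt : G = ∞
  · rw [hGt, ENNReal.mul_top (mul_ne_zero hC0 hF0)]; exact le_top
  have hfp : ∀ n, InLp μ p (f n) := fun n => ⟨hfm n, (hfF n).trans_lt (lt_top_iff_ne_top.2 hFt)⟩
  have hgq : ∀ n, InLp μ q (g n) := fun n => ⟨hgm n, (hgG n).trans_lt (lt_top_iff_ne_top.2 hGt)⟩
  have hTmono : ∀ ω, Monotone fun k => T k ω := fun ω => monotone_nat_of_le_succ fun k => hmono k ω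
  refine eLpNorm_tsum_enorm_le (X := P) hT.pos' (fun k => ?_) (fun K => ?_)
  · obtain ⟨N, hN⟩ := hbd (k + 1)
    have e : P k = paraproduct (localizedPiece f (T k) (T (k + 1)))
        (localizedPiece g (T k) (T (k + 1))) N := by
      ext ω; exact paraproductInfty_localizedPiece _ g (hmono k ω) (hN ω)
    rw [e]
    exact StronglyAdapted.aesm (paraproduct_stronglyAdapted
      (stronglyAdapted_localizedPiece hf.stronglyAdapted (hst k) (hst (k + 1)) (hmono k))
      (stronglyAdapted_localizedPiece hg.stronglyAdapted (hst k) (hst (k + 1)) (hmono k))) N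
  -- A bound for T_K bounds T_{k+1} for all k < K, so a single time N realizes all the terminal
  -- values in the partial sum.
  · obtain ⟨N, hN⟩ := hbd K
    have e : (fun ω => ∑ k ∈ Finset.range K, |P k ω|) = fun ω => ∑ k ∈ Finset.range K,
        |paraproduct (localizedPiece f (T k) (T (k + 1)))
          (localizedPiece g (T k) (T (k + 1))) N ω| := by
      ext ω
      refine Finset.sum_congr rfl fun k hk => ?_
      simp only [P]
      rw [paraproductInfty_localizedPiece _ g (hmono k ω)
        ((hTmono ω (Finset.mem_range.1 hk)).trans (hN ω))]
    rw [e]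
    refine (hC Ω m μ inferInstance ℱ T hst hmono f g hf hg hfp hgq K N).trans ?_
    rw [mul_assoc]
    gcongr
    · exact le_self_add
    · exact hfF N
    · exact hgG N
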